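/- Let $p\ge 1$ and $N\ge 0$ be integers, and put $$j=\begin{bmatrix} I_p&0\\0&-I_p\end{bmatrix},\quad J=\begin{bmatrix}0&I_p\\I_p&0\end{bmatrix},\quad K=\frac1{\sqrt2}\begin{bmatrix} I_p&-I_p\\I_p&I_p\end{bmatrix}.$$ Let $C_k$ be $2p\times 2p$ complex matrices and $\beta(k)$ be $p\times 2p$ complex matrices such that $$C_k=2K^*\beta(k)^*\beta(k)K-j,\qquad \beta(k)J\beta(k)^*=I_p\qquad(0\le k\le N).$$ Let $W_k(\lambda)$, $W_0(\lambda)=I_{2p}$, be the fundamental solution of the discrete Dirac system $$W_{k+1}(\lambda)-W_k(\lambda)=-\frac{i}{\lambda}\,jC_kW_k(\lambda)\qquad(0\le k\le N),$$ and let $\mathcal W(\lambda)=\{\mathcal W_{il}(\lambda)\}_{i,l=1}^2=K\,W_{N+1}(\overline\lambda)^*$, with $p\times p$ blocks $\mathcal W_{il}$. Let $R,Q$ be $p\times p$ matrix functions analytic in a neighbourhood of $\lambda=-i$ such that $$\det\big(\mathcal W_{11}(-i)R(-i)+\mathcal W_{12}(-i)Q(-i)\big)\neq0,$$ and suppose that,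 near $\lambda=-i$, $$\varphi(\lambda)=i\big(\mathcal W_{21}(\lambda)R(\lambda)+\mathcal W_{22}(\lambda)Q(\lambda)\big)\big(\mathcal W_{11}(\lambda)R(\lambda)+\mathcal W_{12}(\lambda)Q(\lambda)\big)^{-1}.$$ Then: 1. $C_k=C_k^*$, $C_kjC_k=j$ and $C_k>0$ for $0\le k\le N$, and $\det\big(\beta(k)J\beta(k+1)^*\big)\ne0$ for $0\le k\le N-1$. 2. The function $z\mapsto i\varphi\big(i\frac{z+1}{z-1}\big)$ is analytic at $z=0$, and the matrices $C_0,\dots,C_N$ are uniquely determined by its first $N+1$ Taylor coefficients $\alpha_0,\dots,\alpha_N$ at $z=0$: if two systems and functions $\varphi$ as above (with the same $p,N$) have the same $\alpha_0,\dots,\alpha_N$, then their $C_k$ coincide for $0\le k\le N$. 3. The system is recovered by the following procedure. For $0\le r\le N$ let $\Pi(r)$ be the $(r+1)p\times 2p$ matrix with block rows $[\,I_p\quad \alpha_0+\dots+\alpha_k\,]$, $0\le k\le r$, let $B(r)$ be the matrix with block rows $\beta(0),\dots,\beta(r)$, and let $\Pi=\Pi(N)$, $B=B(N)$. Let $A$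 be the $(N+1)p\times(N+1)p$ block lower triangular matrix with the blocks $\frac i2I_p$ on the diagonal and $iI_p$ below the diagonal. The matrix identity $$AS-SA^*=i\,\Pi J\Pi^*$$ has a unique solution $S$; this $S$ is positive definite, and $$\Pi^*S^{-1}\Pi=B^*B .$$ Moreover, if $S(r)$ denotes the upper left $(r+1)p\times(r+1)p$ corner of $S$, then $\Pi(r)^*S(r)^{-1}\Pi(r)=B(r)^*B(r)$ for $0\le r\le N$. Consequently $$\beta(0)^*\beta(0)=\Pi(0)^*S(0)^{-1}\Pi(0),\qquad \beta(r)^*\beta(r)=\Pi(r)^*S(r)^{-1}\Pi(r)-\Pi(r-1)^*S(r-1)^{-1}\Pi(r-1)\quad(1\le r\le N),$$ which gives $C_k=2K^*\beta(k)^*\beta(k)K-j$. -/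

import Mathlib

open Matrix Complex Filter Topology
open scoped ComplexOrder ComplexConjugate

namespace DiscreteDirac

noncomputable section

/-- The signature matrix `j = diag(I_p, -I_p)`. -/
def sigj (p : ℕ) : Matrix (Fin p ⊕ Fin p) (Fin p ⊕ Fin p) ℂ :=
  fromBlocks 1 0 0 (-1)

/-- The matrix `J = [0, I_p; I_p, 0]`. -/
def sigJ (p : ℕ) : Matrix (Fin p ⊕ Fin p) (Fin p ⊕ Fin p) ℂ :=
  fromBlocks 0 1 1 0

/-- The unitary matrix `K = 2^{-1/2} [I_p, -I_p; I_p, I_p]`. -/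
def matK (p : ℕ) : Matrix (Fin p ⊕ Fin p) (Fin p ⊕ Fin p) ℂ :=
  ((Real.sqrt 2 : ℝ) : ℂ)⁻¹ • fromBlocks 1 (-1) 1 1

/-- The fundamental solution, normalized by `W_0 = I`, of the discrete Dirac system
`W_{k+1}(l) - W_k(l) = -(i / l) j C_k W_k(l)` (meaningful for `l ≠ 0`). -/
def fundSol {p : ℕ} (C : ℕ → Matrix (Fin p ⊕ Fin p) (Fin p ⊕ Fin p) ℂ) :
    ℕ → ℂ → Matrix (Fin p ⊕ Fin p) (Fin p ⊕ Fin p) ℂ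
  | 0, _ => 1
  | k + 1, l => fundSol C k l - (I / l) • (sigj p * C k * fundSol C k l)

/-- The coefficient matrix of the linear-fractional transformation,
`𝒲(l) = K W_{N+1}(conj l)^*`. -/
def calW {p : ℕ} (N : ℕ) (C : ℕ → Matrix (Fin p ⊕ Fin p) (Fin p ⊕ Fin p) ℂ) (l : ℂ) :
    Matrix (Fin p ⊕ Fin p) (Fin p ⊕ Fin p) ℂ :=
  matK p * (fundSol C (N + 1) (conj l))ᴴ

/-- Near `l = -i`, `φ` is the linear-fractional transform
`φ = i (𝒲₂₁ R + 𝒲₂₂ Q) (𝒲₁₁ R + 𝒲₁₂ Q)⁻¹` of some pair `R`, `Q` of matrix functions analytic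
at `-i`, where the matrix to be inverted is nonsingular at `-i`. -/
def IsMoebiusTransform {p : ℕ} (N : ℕ)
    (C : ℕ → Matrix (Fin p ⊕ Fin p) (Fin p ⊕ Fin p) ℂ)
    (φ : ℂ → Matrix (Fin p) (Fin p) ℂ) : Prop :=
  ∃ R Q : ℂ → Matrix (Fin p) (Fin p) ℂ,
    (∀ a b, AnalyticAt ℂ (fun l => R l a b) (-I)) ∧
    (∀ a b, AnalyticAt ℂ (fun l => Q l a b) (-I)) ∧
    ((calW N C (-I)).toBlocks₁₁ * R (-I) + (calW N C (-I)).toBlocks₁₂ * Q (-I)).det ≠ 0 ∧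
    ∀ᶠ l in 𝓝 (-I), φ l =
      I • (((calW N C l).toBlocks₂₁ * R l + (calW N C l).toBlocks₂₂ * Q l) *
        ((calW N C l).toBlocks₁₁ * R l + (calW N C l).toBlocks₁₂ * Q l)⁻¹)

/-- The system on `0 ≤ k ≤ N` has the form
`C_k = 2 K^* β(k)^* β(k) K - j` with `β(k) J β(k)^* = I_p`. -/
def HasRepresentation {p : ℕ} (N : ℕ)
    (C : ℕ → Matrix (Fin p ⊕ Fin p) (Fin p ⊕ Fin p) ℂ)
    (β : ℕ → Matrix (Fin p) (Fin p ⊕ Fin p) ℂ) : Prop :=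
  ∀ k ≤ N,
    C k = (2 : ℂ) • ((matK p)ᴴ * (β k)ᴴ * β k * matK p) - sigj p ∧
    β k * sigJ p * (β k)ᴴ = 1

/-- The function `z ↦ i φ(i (z + 1) / (z - 1))`. -/
def cayley {p : ℕ} (φ : ℂ → Matrix (Fin p) (Fin p) ℂ) (z : ℂ) : Matrix (Fin p) (Fin p) ℂ :=
  I • φ (I * ((z + 1) / (z - 1)))

/-- The `k`-th Taylor coefficient at `z = 0` of `z ↦ i φ(i (z + 1) / (z - 1))`, entry by entry. -/
def taylorCoeff {p : ℕ} (φ : ℂ → Matrix (Fin p) (Fin p) ℂ) (k : ℕ) :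
    Matrix (Fin p) (Fin p) ℂ :=
  Matrix.of fun a b => iteratedDeriv k (fun z => cayley φ z a b) 0 / (k.factorial : ℂ)

/-- The block lower triangular matrix `A(r)`, with `r + 1` block rows: `i/2 I_p` on the block
diagonal and `i I_p` below it. -/
def matA (p r : ℕ) : Matrix (Fin (r + 1) × Fin p) (Fin (r + 1) × Fin p) ℂ :=
  Matrix.of fun x y =>
    (if y.1 < x.1 then I else if y.1 = x.1 then I / 2 else 0) * (if x.2 = y.2 then 1 else 0)

/-- The matrix `Π(r) = [Φ₁ Φ₂]`: its `k`-th block row is `[I_p, α_0 + ... + α_k]`, `0 ≤ k ≤ r`. -/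
def matPi {p : ℕ} (α : ℕ → Matrix (Fin p) (Fin p) ℂ) (r : ℕ) :
    Matrix (Fin (r + 1) × Fin p) (Fin p ⊕ Fin p) ℂ :=
  Matrix.of fun x c =>
    fromCols (1 : Matrix (Fin p) (Fin p) ℂ)
      (∑ l ∈ Finset.range ((x.1 : ℕ) + 1), α l) x.2 c

/-- The matrix `B(r)` with the block rows `β(0), ..., β(r)`. -/
def matB {p : ℕ} (β : ℕ → Matrix (Fin p) (Fin p ⊕ Fin p) ℂ) (r : ℕ) :
    Matrix (Fin (r + 1) × Fin p) (Fin p ⊕ Fin p) ℂ :=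
  Matrix.of fun x c => β (x.1 : ℕ) x.2 c

/-- The upper left corner of `S` that consists of the first `r + 1` block rows and columns. -/
def leading {p N : ℕ} (S : Matrix (Fin (N + 1) × Fin p) (Fin (N + 1) × Fin p) ℂ)
    (r : ℕ) (hr : r ≤ N) : Matrix (Fin (r + 1) × Fin p) (Fin (r + 1) × Fin p) ℂ :=
  S.submatrix (Prod.map (Fin.castLE (Nat.succ_le_succ hr)) id)
    (Prod.map (Fin.castLE (Nat.succ_le_succ hr)) id)

/-- The matrix `Π(r)^* S(r)⁻¹ Π(r)`, where `S(r)` is the corner of `S` with `r + 1` blocks. -/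
def gram {p N : ℕ} (α : ℕ → Matrix (Fin p) (Fin p) ℂ)
    (S : Matrix (Fin (N + 1) × Fin p) (Fin (N + 1) × Fin p) ℂ) (r : ℕ) (hr : r ≤ N) :
    Matrix (Fin p ⊕ Fin p) (Fin p ⊕ Fin p) ℂ :=
  (matPi α r)ᴴ * (leading S r hr)⁻¹ * matPi α r

end

end DiscreteDirac

/-!
In the variable `z` with `λ = i (z + 1) / (z - 1)` each step of the system becomes, up to a scalar
factor and conjugation by `K`, a pencil `G_l = 1 + (z - 1) γ_l β_l` with `γ_l = J β_l^*` and
`β_l γ_l = 1`. With `ψ(z) = i φ(λ)` the Möbius representation of `φ` therefore reads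
`[-ψ; 1] = G_0 ⋯ G_N h` with an analytic `h`.

The row `[1, ψ]` annihilates the left-hand side, and after multiplication by `G_0` it is divisible
by `z`; the quotient annihilates `G_1 ⋯ G_N h`, and so on. The Taylor coefficients of the successive
quotients form an invertible block lower triangular matrix `L` with `Π = L B` and `A L = L M`, where
`M - M^* = i B J B^*`. Hence `S = L L^*` is positive definite and solves `A S - S A^* = i Π J Π^*`.
The solution is unique because `A - i/2` is nilpotent, and the factorizations of the corners of `S`
give `Π(r)^* S(r)⁻¹ Π(r) = B(r)^* B(r)`.

Positivity of the `C_k` comes from `b^* b - j ≥ 0` for `b = β K` with `b j b^* = 1`, since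
`C = b^* b + (b^* b - j)`.
-/

namespace DiscreteDirac

section Pencil

variable {R m n o : Type*} [CommRing R] [Fintype m] [Fintype n] [Fintype o] [DecidableEq m]
  [DecidableEq n] [DecidableEq o]

/-- The linear matrix pencil `(1 - P) + z P`. It is used with a number `z` and, over the ring of
formal power series, with the variable `z = X`. -/
def pencil (z : R) (P : Matrix o o R) : Matrix o o R := 1 + (z - 1) • P

theorem pencil_mul_of_mul_eq_one {β : Matrix m o R} {γ : Matrix o m R} (h : β * γ = 1) (z : R) :
    pencil z (γ * β) * γ = z • γ := by
  rw [pencil, Matrix.add_mul, Matrix.one_mul, Matrix.smul_mul, Matrix.mul_assoc, h, Matrix.mul_one,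
    sub_smul, one_smul, add_sub_cancel]

theorem mul_pencil_of_mul_eq_one {β : Matrix m o R} {γ : Matrix o m R} (h : β * γ = 1) (z : R) :
    β * pencil z (γ * β) = z • β := by
  rw [pencil, Matrix.mul_add, Matrix.mul_one, Matrix.mul_smul, ← Matrix.mul_assoc, h,
    Matrix.one_mul, sub_smul, one_smul, add_sub_cancel]

theorem mul_pencil_zero {l : Type*} (x : Matrix l o R) (P : Matrix o o R) :
    x * pencil 0 P = x - x * P := by
  simp [pencil, Matrix.mul_add, sub_eq_add_neg]

theorem eq_mul_mul_of_mul_eq_zero {l : Type*} {β : Matrix m (m ⊕ n) R} {γ : Matrix (m ⊕ n) m R}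
    {E : Matrix n (m ⊕ n) R} {F : Matrix (m ⊕ n) n R} {x : Matrix l (m ⊕ n) R}
    (hβγ : β * γ = 1) (hEF : E * F = 1) (hβF : β * F = 0) (hxF : x * F = 0) :
    x = x * (γ * β) := by
  have hunit : IsUnit (fromCols γ F) := by
    have hprod : IsUnit (fromRows β E * fromCols γ F) := by
      rw [fromRows_mul_fromCols, hβγ, hEF, hβF, isUnit_fromBlocks_zero₁₂]
      exact ⟨isUnit_one, isUnit_one⟩
    rw [isUnit_iff_isUnit_det] at hprod ⊢
    rw [det_mul] at hprod
    exact isUnit_of_mul_isUnit_right hprod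
  have hγ : γ * β * γ = γ := by rw [Matrix.mul_assoc, hβγ, Matrix.mul_one]
  have hF : γ * β * F = 0 := by rw [Matrix.mul_assoc, hβF, Matrix.mul_zero]
  have heq : x * fromCols γ F = x * (γ * β) * fromCols γ F := by
    rw [Matrix.mul_assoc, mul_fromCols, mul_fromCols, mul_fromCols, hγ, hF, Matrix.mul_zero, hxF]
  obtain ⟨V, hV⟩ := hunit
  simpa only [Matrix.mul_assoc, ← hV, Units.mul_inv, Matrix.mul_one] using
    congrArg (· * V⁻¹.val) heq

end Pencil

section PowerSeries

open scoped PowerSeries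

variable {R : Type*} [CommRing R] {m n o : Type*}

/-- The `k`-th coefficient of a power series with matrix coefficients; such a series is encoded as
a matrix of scalar power series. -/
noncomputable def coeffMatrix (k : ℕ) : Matrix m n R⟦X⟧ →ₗ[R] Matrix m n R :=
  (PowerSeries.coeff k).mapMatrix

@[simp]
theorem coeffMatrix_apply (k : ℕ) (M : Matrix m n R⟦X⟧) (a : m) (b : n) :
    coeffMatrix k M a b = PowerSeries.coeff k (M a b) := rfl

theorem coeffMatrix_mul_map_C [Fintype n] (k : ℕ) (M : Matrix m n R⟦X⟧) (P : Matrix n o R) :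
    coeffMatrix k (M * P.map PowerSeries.C) = coeffMatrix k M * P := by
  ext a b
  simp [Matrix.mul_apply, PowerSeries.coeff_mul_C]

theorem coeffMatrix_zero_mul [Fintype n] (M : Matrix m n R⟦X⟧) (M' : Matrix n o R⟦X⟧) :
    coeffMatrix 0 (M * M') = coeffMatrix 0 M * coeffMatrix 0 M' := by
  ext a b
  simp [Matrix.mul_apply]

theorem coeffMatrix_zero_pencil_X [DecidableEq n] (P : Matrix n n R) :
    coeffMatrix 0 (pencil (PowerSeries.X : R⟦X⟧) (P.map PowerSeries.C)) = pencil 0 P := by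
  ext a b
  by_cases h : a = b <;> simp [pencil, h]

theorem coeffMatrix_one_apply [DecidableEq n] (k : ℕ) :
    coeffMatrix k (1 : Matrix n n R⟦X⟧) = if k = 0 then 1 else 0 := by
  ext a b
  by_cases h : a = b <;> by_cases hk : k = 0 <;> simp [one_apply, h, hk, PowerSeries.coeff_one]

theorem coeffMatrix_fromCols (k : ℕ) (M : Matrix m n R⟦X⟧) (M' : Matrix m o R⟦X⟧) :
    coeffMatrix k (fromCols M M') = fromCols (coeffMatrix k M) (coeffMatrix k M') := by
  ext a (b | b) <;> rfl

theorem coeffMatrix_fromRows (k : ℕ) (M : Matrix m o R⟦X⟧) (M' : Matrix n o R⟦X⟧) :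
    coeffMatrix k (fromRows M M') = fromRows (coeffMatrix k M) (coeffMatrix k M') := by
  ext (a | a) b <;> rfl

theorem coeffMatrix_X_pow_smul_of_lt {k l : ℕ} (h : k < l) (M : Matrix m n R⟦X⟧) :
    coeffMatrix k ((PowerSeries.X ^ l : R⟦X⟧) • M) = 0 := by
  ext
  simp [PowerSeries.coeff_X_pow_mul', h.not_ge]

theorem coeffMatrix_X_pow_smul_self (l : ℕ) (M : Matrix m n R⟦X⟧) :
    coeffMatrix l ((PowerSeries.X ^ l : R⟦X⟧) • M) = coeffMatrix 0 M := by
  ext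
  simp [PowerSeries.coeff_X_pow_mul']

theorem coeffMatrix_geometric_smul (k : ℕ) (M : Matrix m n R⟦X⟧) :
    coeffMatrix k ((PowerSeries.mk 1 : R⟦X⟧) • M) =
      ∑ i ∈ Finset.range (k + 1), coeffMatrix i M := by
  ext a b
  rw [coeffMatrix_apply, Matrix.smul_apply, smul_eq_mul, mul_comm, PowerSeries.coeff_mul,
    Finset.Nat.sum_antidiagonal_eq_sum_range_succ_mk]
  simp [Matrix.sum_apply]

theorem sum_coeffMatrix_X_smul (k : ℕ) (M : Matrix m n R⟦X⟧) :
    ∑ i ∈ Finset.range (k + 1), coeffMatrix i ((PowerSeries.X : R⟦X⟧) • M) =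
      ∑ i ∈ Finset.range k, coeffMatrix i M := by
  have hzero : coeffMatrix 0 ((PowerSeries.X : R⟦X⟧) • M) = 0 := by
    simpa only [pow_one] using coeffMatrix_X_pow_smul_of_lt zero_lt_one M
  have hsucc (i : ℕ) : coeffMatrix (i + 1) ((PowerSeries.X : R⟦X⟧) • M) = coeffMatrix i M := by
    ext
    simp [PowerSeries.coeff_succ_X_mul]
  rw [Finset.sum_range_succ', hzero, add_zero]
  simp only [hsucc]

theorem X_smul_cancel {M M' : Matrix m n R⟦X⟧}
    (h : (PowerSeries.X : R⟦X⟧) • M = (PowerSeries.X : R⟦X⟧) • M') : M = M' := by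
  ext1 a b
  exact PowerSeries.X_mul_cancel (congrFun (congrFun h a) b)

/-- Division by `X` of a matrix of power series, discarding the constant term. -/
noncomputable def divX (M : Matrix m n R⟦X⟧) : Matrix m n R⟦X⟧ :=
  M.map fun f => PowerSeries.mk fun k => PowerSeries.coeff (k + 1) f

theorem X_smul_divX {M : Matrix m n R⟦X⟧} (h : coeffMatrix 0 M = 0) :
    (PowerSeries.X : R⟦X⟧) • divX M = M := by
  ext1 a b
  have hzero : PowerSeries.constantCoeff (M a b) = 0 := by
    simpa using congrFun (congrFun h a) b
  have := PowerSeries.sub_const_eq_X_mul_shift (M a b)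
  rw [hzero, map_zero, sub_zero] at this
  exact this.symm

end PowerSeries

section PencilChain

open scoped PowerSeries

variable {R m n : Type*} [CommRing R] [Fintype m] [Fintype n] [DecidableEq m] [DecidableEq n]

/-- A factorization `[-ψ; 1] = G_0 ⋯ G_{N-1} F_N` into the pencils `G_l = 1 + (X - 1) γ_l β_l`,
where `β_l γ_l = 1`, recorded by the partial products `F_l = G_l ⋯ G_{N-1} F_N`. This is the form
in which the Möbius representation of the Weyl function enters the algebra. -/
structure IsPencilChain (N : ℕ) (ψ : Matrix m n R⟦X⟧) (β : ℕ → Matrix m (m ⊕ n) R)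
    (γ : ℕ → Matrix (m ⊕ n) m R) (F : ℕ → Matrix (m ⊕ n) n R⟦X⟧) : Prop where
  mul_eq_one : ∀ l < N, β l * γ l = 1
  zero : F 0 = fromRows (-ψ) 1
  step : ∀ l < N, F l = pencil PowerSeries.X ((γ l * β l).map PowerSeries.C) * F (l + 1)

/-- The rows `ρ_0 = [1, ψ]`, `ρ_{l+1} = X⁻¹ ρ_l G_l` with the pencil `G_l = 1 + (X - 1) γ_l β_l`;
along a pencil chain these divisions by `X` are exact. -/
noncomputable def quotientRow (ψ : Matrix m n R⟦X⟧) (β : ℕ → Matrix m (m ⊕ n) R)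
    (γ : ℕ → Matrix (m ⊕ n) m R) : ℕ → Matrix m (m ⊕ n) R⟦X⟧
  | 0 => fromCols 1 ψ
  | l + 1 => divX (quotientRow ψ β γ l *
      pencil PowerSeries.X ((γ l * β l).map PowerSeries.C))

/-- The block `(k, l)` of the triangular factor: the `k`-th coefficient of `X^l ρ_l γ_l`. -/
noncomputable def triangularFactor (ψ : Matrix m n R⟦X⟧) (β : ℕ → Matrix m (m ⊕ n) R)
    (γ : ℕ → Matrix (m ⊕ n) m R) (k l : ℕ) : Matrix m m R :=
  coeffMatrix k ((PowerSeries.X ^ l : R⟦X⟧) • quotientRow ψ β γ l) * γ l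

theorem triangularFactor_eq_zero_of_lt {ψ : Matrix m n R⟦X⟧} {β : ℕ → Matrix m (m ⊕ n) R}
    {γ : ℕ → Matrix (m ⊕ n) m R} {k l : ℕ} (h : k < l) : triangularFactor ψ β γ k l = 0 := by
  rw [triangularFactor, coeffMatrix_X_pow_smul_of_lt h, Matrix.zero_mul]

theorem triangularFactor_self {ψ : Matrix m n R⟦X⟧} {β : ℕ → Matrix m (m ⊕ n) R}
    {γ : ℕ → Matrix (m ⊕ n) m R} (l : ℕ) :
    triangularFactor ψ β γ l l = coeffMatrix 0 (quotientRow ψ β γ l) * γ l := by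
  rw [triangularFactor, coeffMatrix_X_pow_smul_self]

namespace IsPencilChain

variable {N : ℕ} {ψ : Matrix m n R⟦X⟧} {β : ℕ → Matrix m (m ⊕ n) R} {γ : ℕ → Matrix (m ⊕ n) m R}
  {F : ℕ → Matrix (m ⊕ n) n R⟦X⟧}

theorem mono (h : IsPencilChain N ψ β γ F) {M : ℕ} (hM : M ≤ N) : IsPencilChain M ψ β γ F :=
  ⟨fun l hl => h.mul_eq_one l (hl.trans_le hM), h.zero, fun l hl => h.step l (hl.trans_le hM)⟩

theorem coeffMatrix_zero_step (h : IsPencilChain N ψ β γ F) {l : ℕ} (hl : l < N) :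
    coeffMatrix 0 (F l) = pencil 0 (γ l * β l) * coeffMatrix 0 (F (l + 1)) := by
  rw [h.step l hl, coeffMatrix_zero_mul, coeffMatrix_zero_pencil_X]

theorem exists_mul_coeffMatrix_zero_eq_one (h : IsPencilChain N ψ β γ F) {l : ℕ} (hl : l ≤ N) :
    ∃ E : Matrix n (m ⊕ n) R, E * coeffMatrix 0 (F l) = 1 := by
  induction l with
  | zero =>
    refine ⟨fromCols 0 1, ?_⟩
    rw [h.zero, coeffMatrix_fromRows, coeffMatrix_one_apply, fromCols_mul_fromRows, if_pos rfl,
      Matrix.zero_mul, Matrix.one_mul, zero_add]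
  | succ l ih =>
    obtain ⟨E, hE⟩ := ih (by omega)
    exact ⟨E * pencil 0 (γ l * β l), by rw [Matrix.mul_assoc, ← h.coeffMatrix_zero_step hl, hE]⟩

theorem coeffMatrix_zero_quotientRow_of_mul_eq_zero (h : IsPencilChain N ψ β γ F) {l : ℕ}
    (hl : l < N) (hzero : quotientRow ψ β γ l * F l = 0) :
    coeffMatrix 0 (quotientRow ψ β γ l) = coeffMatrix 0 (quotientRow ψ β γ l) * (γ l * β l) := by
  obtain ⟨E, hE⟩ := h.exists_mul_coeffMatrix_zero_eq_one hl.le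
  refine eq_mul_mul_of_mul_eq_zero (h.mul_eq_one l hl) hE ?_ ?_
  · rw [h.coeffMatrix_zero_step hl, ← Matrix.mul_assoc,
      mul_pencil_of_mul_eq_one (h.mul_eq_one l hl), zero_smul, Matrix.zero_mul]
  · rw [← coeffMatrix_zero_mul, hzero, map_zero]

theorem X_smul_quotientRow_succ_of_mul_eq_zero (h : IsPencilChain N ψ β γ F) {l : ℕ} (hl : l < N)
    (hzero : quotientRow ψ β γ l * F l = 0) :
    (PowerSeries.X : R⟦X⟧) • quotientRow ψ β γ (l + 1) =
      quotientRow ψ β γ l * pencil PowerSeries.X ((γ l * β l).map PowerSeries.C) := by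
  refine X_smul_divX ?_
  rw [coeffMatrix_zero_mul, coeffMatrix_zero_pencil_X, mul_pencil_zero, sub_eq_zero]
  exact h.coeffMatrix_zero_quotientRow_of_mul_eq_zero hl hzero

theorem quotientRow_mul_eq_zero (h : IsPencilChain N ψ β γ F) {l : ℕ} (hl : l ≤ N) :
    quotientRow ψ β γ l * F l = 0 := by
  induction l with
  | zero =>
    rw [quotientRow, h.zero, fromCols_mul_fromRows, Matrix.one_mul, Matrix.mul_one, neg_add_cancel]
  | succ l ih =>
    have hzero := ih (by omega)
    refine X_smul_cancel ?_
    rw [← Matrix.smul_mul, h.X_smul_quotientRow_succ_of_mul_eq_zero hl hzero, Matrix.mul_assoc,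
      ← h.step l hl, hzero, smul_zero]

theorem coeffMatrix_zero_quotientRow (h : IsPencilChain N ψ β γ F) {l : ℕ} (hl : l < N) :
    coeffMatrix 0 (quotientRow ψ β γ l) = coeffMatrix 0 (quotientRow ψ β γ l) * (γ l * β l) :=
  h.coeffMatrix_zero_quotientRow_of_mul_eq_zero hl (h.quotientRow_mul_eq_zero hl.le)

theorem X_smul_quotientRow_succ (h : IsPencilChain N ψ β γ F) {l : ℕ} (hl : l < N) :
    (PowerSeries.X : R⟦X⟧) • quotientRow ψ β γ (l + 1) =
      quotientRow ψ β γ l * pencil PowerSeries.X ((γ l * β l).map PowerSeries.C) :=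
  h.X_smul_quotientRow_succ_of_mul_eq_zero hl (h.quotientRow_mul_eq_zero hl.le)

theorem quotientRow_succ_mul (h : IsPencilChain N ψ β γ F) {l : ℕ} (hl : l < N) :
    quotientRow ψ β γ (l + 1) * (γ l).map PowerSeries.C =
      quotientRow ψ β γ l * (γ l).map PowerSeries.C := by
  have hβγ : (β l).map PowerSeries.C * (γ l).map PowerSeries.C = 1 := by
    rw [← Matrix.map_mul, h.mul_eq_one l hl, Matrix.map_one _ (map_zero _) (map_one _)]
  refine X_smul_cancel ?_
  rw [← Matrix.smul_mul, h.X_smul_quotientRow_succ hl, Matrix.map_mul, Matrix.mul_assoc,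
    pencil_mul_of_mul_eq_one hβγ, Matrix.mul_smul]

theorem isUnit_triangularFactor_self (h : IsPencilChain N ψ β γ F) {l : ℕ} (hl : l < N) :
    IsUnit (triangularFactor ψ β γ l l) := by
  simp only [triangularFactor_self]
  induction l with
  | zero =>
    have hright : coeffMatrix 0 (quotientRow ψ β γ 0) * γ 0 *
        (β 0 * fromRows (1 : Matrix m m R) (0 : Matrix n m R)) = 1 := by
      rw [Matrix.mul_assoc, ← Matrix.mul_assoc (γ 0), ← Matrix.mul_assoc,
        ← h.coeffMatrix_zero_quotientRow hl, quotientRow, coeffMatrix_fromCols,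
        coeffMatrix_one_apply, fromCols_mul_fromRows, if_pos rfl, Matrix.one_mul, Matrix.mul_zero,
        add_zero]
    exact IsUnit.of_mul_eq_one _ hright
  | succ l ih =>
    have hprod : coeffMatrix 0 (quotientRow ψ β γ (l + 1)) * γ (l + 1) * (β (l + 1) * γ l) =
        coeffMatrix 0 (quotientRow ψ β γ l) * γ l := by
      rw [Matrix.mul_assoc, ← Matrix.mul_assoc (γ (l + 1)), ← Matrix.mul_assoc,
        ← h.coeffMatrix_zero_quotientRow hl, ← coeffMatrix_mul_map_C,
        h.quotientRow_succ_mul (by omega), coeffMatrix_mul_map_C]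
    have hunit := ih (by omega)
    rw [← hprod, isUnit_iff_isUnit_det, det_mul] at hunit
    exact (isUnit_iff_isUnit_det _).mpr (isUnit_of_mul_isUnit_left hunit)

theorem X_pow_smul_quotientRow (h : IsPencilChain N ψ β γ F) {l : ℕ} (hl : l ≤ N) :
    (PowerSeries.X ^ l : R⟦X⟧) • quotientRow ψ β γ l =
      (PowerSeries.X ^ N : R⟦X⟧) • quotientRow ψ β γ N +
      (1 - PowerSeries.X : R⟦X⟧) • ∑ k ∈ Finset.Ico l N,
        ((PowerSeries.X ^ k : R⟦X⟧) • quotientRow ψ β γ k) * (γ k * β k).map PowerSeries.C := by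
  induction hl using Nat.decreasingInduction with
  | self => simp
  | of_succ l hl ih =>
    have hstep : (PowerSeries.X ^ (l + 1) : R⟦X⟧) • quotientRow ψ β γ (l + 1) =
        (PowerSeries.X ^ l : R⟦X⟧) • quotientRow ψ β γ l -
          (1 - PowerSeries.X : R⟦X⟧) • (((PowerSeries.X ^ l : R⟦X⟧) • quotientRow ψ β γ l) *
            (γ l * β l).map PowerSeries.C) := by
      rw [pow_succ, mul_smul, h.X_smul_quotientRow_succ hl, pencil, ← Matrix.smul_mul,
        Matrix.mul_add, Matrix.mul_one, Matrix.mul_smul, ← neg_sub 1 PowerSeries.X, neg_smul,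
        ← sub_eq_add_neg]
    rw [Finset.sum_eq_sum_Ico_succ_bot hl, smul_add, add_left_comm, ← ih, hstep, add_sub_cancel]

theorem sum_coeffMatrix_X_pow_smul_quotientRow (h : IsPencilChain N ψ β γ F) {k l : ℕ}
    (hk : k < N) (hl : l ≤ N) :
    ∑ i ∈ Finset.range (k + 1),
        coeffMatrix i ((PowerSeries.X ^ l : R⟦X⟧) • quotientRow ψ β γ l) =
      ∑ i ∈ Finset.Ico l N, triangularFactor ψ β γ k i * β i := by
  rw [← coeffMatrix_geometric_smul, h.X_pow_smul_quotientRow hl, smul_add, smul_smul, smul_smul,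
    PowerSeries.mk_one_mul_one_sub_eq_one, one_smul, mul_comm, mul_smul, map_add,
    coeffMatrix_X_pow_smul_of_lt hk, zero_add, map_sum]
  simp only [coeffMatrix_mul_map_C, triangularFactor, Matrix.mul_assoc]

theorem sum_triangularFactor_mul (h : IsPencilChain N ψ β γ F) {k : ℕ} (hk : k < N) :
    ∑ l ∈ Finset.range N, triangularFactor ψ β γ k l * β l =
      fromCols 1 (∑ i ∈ Finset.range (k + 1), coeffMatrix i ψ) := by
  rw [Finset.range_eq_Ico, ← h.sum_coeffMatrix_X_pow_smul_quotientRow hk (Nat.zero_le N)]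
  simp only [pow_zero, one_smul, quotientRow, coeffMatrix_fromCols, coeffMatrix_one_apply]
  ext a (b | b)
  · rw [Finset.sum_range_succ']
    simp [Matrix.sum_apply]
  · simp [Matrix.sum_apply]

theorem sum_triangularFactor (h : IsPencilChain N ψ β γ F) {k l : ℕ} (hk : k < N) (hl : l < N) :
    ∑ i ∈ Finset.range k, triangularFactor ψ β γ i l =
      ∑ i ∈ Finset.Ico (l + 1) N, triangularFactor ψ β γ k i * (β i * γ l) := by
  have hsucc : ((PowerSeries.X ^ (l + 1) : R⟦X⟧) • quotientRow ψ β γ (l + 1)) *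
      (γ l).map PowerSeries.C = (PowerSeries.X : R⟦X⟧) •
        (((PowerSeries.X ^ l : R⟦X⟧) • quotientRow ψ β γ l) * (γ l).map PowerSeries.C) := by
    rw [Matrix.smul_mul, h.quotientRow_succ_mul hl, pow_succ', mul_smul, Matrix.smul_mul]
  simp only [← Matrix.mul_assoc]
  rw [← Matrix.sum_mul, ← h.sum_coeffMatrix_X_pow_smul_quotientRow hk hl, Matrix.sum_mul]
  simp only [← coeffMatrix_mul_map_C, hsucc, sum_coeffMatrix_X_smul, triangularFactor]

end IsPencilChain

end PencilChain

section BlockMatrices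

section Ring

variable {R m n : Type*}

/-- The block matrix with the blocks `L k l`, `k, l < r`, of a doubly infinite array. -/
def blockMatrix (r : ℕ) (L : ℕ → ℕ → Matrix m m R) : Matrix (Fin r × m) (Fin r × m) R :=
  Matrix.comp _ _ _ _ R (of fun k l : Fin r => L k l)

/-- The block column with the blocks `β k`, `k < r`, of an infinite sequence. -/
def blockColumn (r : ℕ) (β : ℕ → Matrix m n R) : Matrix (Fin r × m) n R :=
  of fun x => β x.1 x.2

theorem blockMatrix_congr {r : ℕ} {L L' : ℕ → ℕ → Matrix m m R}
    (h : ∀ k < r, ∀ l < r, L k l = L' k l) : blockMatrix r L = blockMatrix r L' := by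
  ext x y
  exact congrFun (congrFun (h x.1 x.1.2 y.1 y.1.2) x.2) y.2

theorem blockColumn_congr {r : ℕ} {β β' : ℕ → Matrix m n R} (h : ∀ k < r, β k = β' k) :
    blockColumn r β = blockColumn r β' := by
  ext x c
  exact congrFun (congrFun (h x.1 x.1.2) x.2) c

theorem blockMatrix_mul_blockMatrix [Fintype m] [NonUnitalNonAssocSemiring R] (r : ℕ)
    (L L' : ℕ → ℕ → Matrix m m R) :
    blockMatrix r L * blockMatrix r L' =
      blockMatrix r fun k l => ∑ i ∈ Finset.range r, L k i * L' i l := by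
  ext x y
  simp [blockMatrix, Matrix.mul_apply, Matrix.sum_apply, Fintype.sum_prod_type, Finset.sum_range]

theorem blockMatrix_mul_blockColumn [Fintype m] [NonUnitalNonAssocSemiring R] (r : ℕ)
    (L : ℕ → ℕ → Matrix m m R) (β : ℕ → Matrix m n R) :
    blockMatrix r L * blockColumn r β =
      blockColumn r fun k => ∑ i ∈ Finset.range r, L k i * β i := by
  ext x c
  simp [blockMatrix, blockColumn, Matrix.mul_apply, Matrix.sum_apply, Fintype.sum_prod_type,
    Finset.sum_range]

theorem blockMatrix_conjTranspose [Star R] (r : ℕ) (L : ℕ → ℕ → Matrix m m R) :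
    (blockMatrix r L)ᴴ = blockMatrix r fun k l => (L l k)ᴴ := rfl

theorem blockColumn_mul_mul_conjTranspose [Fintype n] [NonUnitalSemiring R] [StarRing R] (r : ℕ)
    (β : ℕ → Matrix m n R) (X : Matrix n n R) :
    blockColumn r β * X * (blockColumn r β)ᴴ = blockMatrix r fun k l => β k * X * (β l)ᴴ := by
  ext x y
  simp [blockMatrix, blockColumn, Matrix.mul_apply]

theorem blockColumn_conjTranspose_mul [Fintype m] [NonUnitalNonAssocSemiring R] [StarRing R] (r : ℕ)
    (β : ℕ → Matrix m n R) :
    (blockColumn r β)ᴴ * blockColumn r β = ∑ k ∈ Finset.range r, (β k)ᴴ * β k := by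
  ext a b
  simp [blockColumn, Matrix.mul_apply, Matrix.sum_apply, Fintype.sum_prod_type, Finset.sum_range]

theorem isUnit_blockMatrix [CommRing R] [Fintype m] [DecidableEq m] {r : ℕ}
    {L : ℕ → ℕ → Matrix m m R} (hlower : ∀ k l, k < l → L k l = 0)
    (hdiag : ∀ k < r, IsUnit (L k k)) : IsUnit (blockMatrix r L) := by
  have htri : (blockMatrix r L).BlockTriangular (fun x => OrderDual.toDual x.1) :=
    fun x y hxy => congrFun (congrFun (hlower x.1 y.1 hxy) x.2) y.2
  have hblock (k : Fin r) :
      ((blockMatrix r L).toSquareBlock (fun x => OrderDual.toDual x.1) (OrderDual.toDual k)).det =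
        (L k k).det := by
    let e : m ≃ {x : Fin r × m // OrderDual.toDual x.1 = OrderDual.toDual k} :=
      { toFun := fun a => ⟨(k, a), rfl⟩
        invFun := fun x => x.1.2
        left_inv := fun _ => rfl
        right_inv := fun ⟨⟨_, _⟩, hx⟩ => Subtype.ext (Prod.ext hx.symm rfl) }
    exact (det_submatrix_equiv_self e _).symm
  rw [isUnit_iff_isUnit_det, htri.det_fintype]
  refine IsUnit.prod_univ_iff.mpr fun k => ?_
  exact (hblock (OrderDual.ofDual k)).symm ▸ (isUnit_iff_isUnit_det _).mp (hdiag _ (Fin.is_lt _))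

theorem isNilpotent_of_eq_zero_of_le [CommRing R] [Fintype m] [DecidableEq m] {α : Type*}
    [LinearOrder α] {M : Matrix m m R} {b : m → α} (h : ∀ i j, b j ≤ b i → M i j = 0) :
    IsNilpotent M := by
  have htri : M.BlockTriangular b := fun i j hij => h i j hij.le
  have hblock (a : α) : M.toSquareBlock b a = 0 := by
    ext i j
    exact h i j (j.2.trans i.2.symm).le
  have hCH := M.aeval_self_charpoly
  rw [htri.charpoly] at hCH
  simp only [hblock, charpoly_zero, Finset.prod_pow_eq_pow_sum, map_pow, Polynomial.aeval_X] at hCH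
  exact ⟨_, hCH⟩

theorem eq_zero_of_semiconjBy_isUnit_isNilpotent {S : Type*} [MonoidWithZero S] {d u a : S}
    (h : SemiconjBy d u a) (hu : IsUnit u) (ha : IsNilpotent a) : d = 0 := by
  obtain ⟨k, hk⟩ := ha
  have hpow : d * u ^ k = 0 := by rw [(h.pow_right k).eq, hk, zero_mul]
  exact (hu.pow k).mul_left_eq_zero.mp hpow

end Ring

theorem conjTranspose_mul_inv_mul_of_mul_eq {R m n : Type*} [Fintype m] [DecidableEq m]
    [CommRing R] [StarRing R] {L : Matrix m m R} {B P : Matrix m n R} (hL : IsUnit L)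
    (h : L * B = P) : Pᴴ * (L * Lᴴ)⁻¹ * P = Bᴴ * B := by
  have hdet : IsUnit L.det := (isUnit_iff_isUnit_det _).mp hL
  have hdetH : IsUnit Lᴴ.det := by
    rw [det_conjTranspose]
    exact hdet.star
  rw [← h, conjTranspose_mul, Matrix.mul_inv_rev]
  calc Bᴴ * Lᴴ * (Lᴴ⁻¹ * L⁻¹) * (L * B) = Bᴴ * (Lᴴ * Lᴴ⁻¹) * (L⁻¹ * L * B) := by
        simp only [Matrix.mul_assoc]
    _ = Bᴴ * B := by
        rw [mul_nonsing_inv _ hdetH, nonsing_inv_mul _ hdet, Matrix.mul_one, Matrix.one_mul]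

theorem leading_blockMatrix {p N r : ℕ} (hr : r ≤ N) (L : ℕ → ℕ → Matrix (Fin p) (Fin p) ℂ) :
    leading (blockMatrix (N + 1) L) r hr = blockMatrix (r + 1) L := rfl

theorem leading_mul_conjTranspose {p N r : ℕ} (hr : r ≤ N)
    {L : ℕ → ℕ → Matrix (Fin p) (Fin p) ℂ} (hlower : ∀ k l, k < l → L k l = 0) :
    leading (blockMatrix (N + 1) L * (blockMatrix (N + 1) L)ᴴ) r hr =
      blockMatrix (r + 1) L * (blockMatrix (r + 1) L)ᴴ := by
  rw [blockMatrix_conjTranspose, blockMatrix_conjTranspose, blockMatrix_mul_blockMatrix,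
    blockMatrix_mul_blockMatrix, leading_blockMatrix]
  refine blockMatrix_congr fun k hk l _ => (Finset.sum_subset
    (Finset.range_mono (Nat.succ_le_succ hr)) fun i _ hi => ?_).symm
  rw [hlower k i (hk.trans_le (by simpa using hi)), Matrix.zero_mul]

end BlockMatrices

section Heaviside

/-- The discrete Heaviside function of `k - l`, with the value `1/2` at the jump. The matrix
`A` of the recovery procedure has the blocks `i θ(k, l) I_p`. -/
noncomputable def heaviside (k l : ℕ) : ℂ := if l < k then 1 else if l = k then 1 / 2 else 0

theorem heaviside_self (k : ℕ) : heaviside k k = 1 / 2 := by simp [heaviside]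

theorem heaviside_of_lt {k l : ℕ} (h : l < k) : heaviside k l = 1 := if_pos h

theorem heaviside_of_gt {k l : ℕ} (h : k < l) : heaviside k l = 0 := by
  rw [heaviside, if_neg h.not_gt, if_neg h.ne']

theorem heaviside_add_heaviside_swap (k l : ℕ) : heaviside k l + heaviside l k = 1 := by
  rcases lt_trichotomy k l with h | rfl | h
  · rw [heaviside_of_lt h, heaviside_of_gt h, zero_add]
  · rw [heaviside_self, add_halves]
  · rw [heaviside_of_lt h, heaviside_of_gt h, add_zero]

theorem star_heaviside (k l : ℕ) : star (heaviside k l) = heaviside k l := by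
  unfold heaviside
  split_ifs <;> simp

theorem sum_range_eq_add_add_sum_Ico {M : Type*} [AddCommMonoid M] {k r : ℕ} (hk : k < r)
    (x : ℕ → M) : ∑ i ∈ Finset.range r, x i =
      ∑ i ∈ Finset.range k, x i + x k + ∑ i ∈ Finset.Ico (k + 1) r, x i := by
  rw [← Finset.sum_range_succ, Finset.sum_range_add_sum_Ico _ hk]

variable {M : Type*} [AddCommGroup M] [Module ℂ M]

theorem sum_heaviside_smul {k r : ℕ} (hk : k < r) (x : ℕ → M) :
    ∑ i ∈ Finset.range r, heaviside k i • x i =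
      ∑ i ∈ Finset.range k, x i + (1 / 2 : ℂ) • x k := by
  have hbelow : ∑ i ∈ Finset.range k, heaviside k i • x i = ∑ i ∈ Finset.range k, x i :=
    Finset.sum_congr rfl fun i hi => by
      rw [heaviside_of_lt (Finset.mem_range.mp hi), one_smul]
  have habove : ∑ i ∈ Finset.Ico (k + 1) r, heaviside k i • x i = 0 :=
    Finset.sum_eq_zero fun i hi => by
      rw [heaviside_of_gt (Finset.mem_Ico.mp hi).1, zero_smul]
  rw [sum_range_eq_add_add_sum_Ico hk, hbelow, habove, heaviside_self, add_zero]

theorem sum_heaviside_swap_smul {l r : ℕ} (hl : l < r) (x : ℕ → M) :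
    ∑ i ∈ Finset.range r, heaviside i l • x i =
      ∑ i ∈ Finset.Ico (l + 1) r, x i + (1 / 2 : ℂ) • x l := by
  have hbelow : ∑ i ∈ Finset.range l, heaviside i l • x i = 0 :=
    Finset.sum_eq_zero fun i hi => by
      rw [heaviside_of_gt (Finset.mem_range.mp hi), zero_smul]
  have habove : ∑ i ∈ Finset.Ico (l + 1) r, heaviside i l • x i = ∑ i ∈ Finset.Ico (l + 1) r, x i :=
    Finset.sum_congr rfl fun i hi => by
      rw [heaviside_of_lt (Finset.mem_Ico.mp hi).1, one_smul]
  rw [sum_range_eq_add_add_sum_Ico hl, hbelow, habove, heaviside_self, zero_add, add_comm]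

end Heaviside

section Sylvester

/-- The block lower triangular matrix with the blocks `i/2 β_k γ_k` on the diagonal and `i β_k γ_l`
below it; it plays for the matrix of the `β_k` the part that `A` plays for `Π`. -/
noncomputable def triangularModel {m o : Type*} [Fintype o] (r : ℕ) (β : ℕ → Matrix m o ℂ)
    (γ : ℕ → Matrix o m ℂ) : Matrix (Fin r × m) (Fin r × m) ℂ :=
  blockMatrix r fun k l => (I * heaviside k l) • (β k * γ l)

theorem matA_eq_blockMatrix (p r : ℕ) :
    matA p r = blockMatrix (r + 1) fun k l => (I * heaviside k l) • 1 := by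
  ext ⟨k, a⟩ ⟨l, b⟩
  rcases lt_trichotomy l k with h | rfl | h
  · simp [matA, blockMatrix, h, heaviside_of_lt (Fin.lt_def.mp h), one_apply]
  · simp [matA, blockMatrix, heaviside_self, one_apply, div_eq_mul_inv]
  · simp [matA, blockMatrix, h.not_gt, h.ne', heaviside_of_gt (Fin.lt_def.mp h)]

theorem eq_zero_of_matA_mul_eq {p r : ℕ} {D : Matrix (Fin (r + 1) × Fin p) (Fin (r + 1) × Fin p) ℂ}
    (h : matA p r * D = D * (matA p r)ᴴ) : D = 0 := by
  have hnil : IsNilpotent (matA p r - algebraMap ℂ _ (I / 2)) := by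
    refine isNilpotent_of_eq_zero_of_le (b := fun x => OrderDual.toDual x.1) fun x y hxy => ?_
    rcases (OrderDual.toDual_le_toDual.mp hxy).lt_or_eq with hlt | heq
    · simp [matA, algebraMap_matrix_apply, hlt.not_gt, hlt.ne', (ne_of_apply_ne Prod.fst hlt.ne)]
    · by_cases ha : x.2 = y.2 <;>
      simp [matA, algebraMap_matrix_apply, heq, ha, Prod.ext_iff]
  have hsplit : (matA p r)ᴴ - algebraMap ℂ _ (I / 2) =
      (matA p r - algebraMap ℂ _ (I / 2))ᴴ + algebraMap ℂ _ (-I) := by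
    rw [conjTranspose_sub, ← star_eq_conjTranspose (algebraMap ℂ _ _), ← algebraMap_star_comm,
      sub_add, ← map_sub]
    congr 2
    simp only [star_div₀, star_def, conj_I, star_ofNat]
    ring
  have hunit : IsUnit ((matA p r)ᴴ - algebraMap ℂ _ (I / 2)) := by
    obtain ⟨k, hk⟩ := hnil
    have hnilH : IsNilpotent (matA p r - algebraMap ℂ _ (I / 2))ᴴ :=
      ⟨k, by rw [← conjTranspose_pow, hk, conjTranspose_zero]⟩
    rw [hsplit]
    exact hnilH.isUnit_add_right_of_commute ((IsUnit.mk0 (-I) (neg_ne_zero.mpr I_ne_zero)).map _)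
      (Algebra.commutes _ _).symm
  exact eq_zero_of_semiconjBy_isUnit_isNilpotent
    (SemiconjBy.sub_right h.symm (Algebra.commutes _ _).symm) hunit hnil

theorem triangularModel_sub_conjTranspose {m o : Type*} [Fintype o] (r : ℕ)
    (β : ℕ → Matrix m o ℂ) {J : Matrix o o ℂ} (hJ : J.IsHermitian) :
    triangularModel r β (fun k => J * (β k)ᴴ) - (triangularModel r β fun k => J * (β k)ᴴ)ᴴ =
      I • (blockColumn r β * J * (blockColumn r β)ᴴ) := by
  rw [triangularModel, blockMatrix_conjTranspose, blockColumn_mul_mul_conjTranspose]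
  ext x y
  have hherm : (β y.1 * J * (β x.1)ᴴ)ᴴ = β x.1 * J * (β y.1)ᴴ := by
    rw [conjTranspose_mul, conjTranspose_mul, conjTranspose_conjTranspose, hJ.eq, Matrix.mul_assoc]
  have hsum := heaviside_add_heaviside_swap x.1 y.1
  simp only [blockMatrix, comp_apply, of_apply, Matrix.sub_apply, Matrix.smul_apply,
    conjTranspose_smul, hherm, star_mul', star_heaviside, star_def, conj_I, smul_eq_mul,
    ← Matrix.mul_assoc]
  linear_combination (I * (β x.1 * J * (β y.1)ᴴ) x.2 y.2) * hsum

theorem matA_mul_blockMatrix {p N : ℕ} {o : Type*} [Fintype o]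
    {L : ℕ → ℕ → Matrix (Fin p) (Fin p) ℂ} {β : ℕ → Matrix (Fin p) o ℂ}
    {γ : ℕ → Matrix o (Fin p) ℂ} (hβγ : ∀ l < N + 1, β l * γ l = 1)
    (hL : ∀ k < N + 1, ∀ l < N + 1, ∑ i ∈ Finset.range k, L i l =
      ∑ i ∈ Finset.Ico (l + 1) (N + 1), L k i * (β i * γ l)) :
    matA p N * blockMatrix (N + 1) L = blockMatrix (N + 1) L * triangularModel (N + 1) β γ := by
  rw [matA_eq_blockMatrix, triangularModel, blockMatrix_mul_blockMatrix,
    blockMatrix_mul_blockMatrix]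
  refine blockMatrix_congr fun k hk l hl => ?_
  simp only [Matrix.smul_mul, Matrix.mul_smul, Matrix.one_mul, mul_smul, ← Finset.smul_sum]
  rw [sum_heaviside_smul hk (L · l), sum_heaviside_swap_smul hl fun i => L k i * (β i * γ l),
    hL k hk l hl, hβγ l hl, Matrix.mul_one]

end Sylvester

section Positivity

variable {𝕜 m n : Type*} [RCLike 𝕜] [Fintype m] [Fintype n] [DecidableEq m] [DecidableEq n]

theorem mul_inv_one_add_gram_mul_conjTranspose (b : Matrix m n 𝕜) :
    b * (1 + bᴴ * b)⁻¹ * bᴴ = 1 - (1 + b * bᴴ)⁻¹ := by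
  have hD : IsUnit (1 + bᴴ * b).det := (isUnit_iff_isUnit_det _).mp
    (PosDef.one.add_posSemidef (posSemidef_conjTranspose_mul_self b)).isUnit
  have hG : IsUnit (1 + b * bᴴ).det := (isUnit_iff_isUnit_det _).mp
    (PosDef.one.add_posSemidef (posSemidef_self_mul_conjTranspose b)).isUnit
  have hpush : (1 + b * bᴴ) * b = b * (1 + bᴴ * b) := by
    rw [Matrix.add_mul, Matrix.mul_add, Matrix.one_mul, Matrix.mul_one, Matrix.mul_assoc]
  have hinv : b * (1 + bᴴ * b)⁻¹ = (1 + b * bᴴ)⁻¹ * b := by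
    rw [← mul_nonsing_inv_cancel_right _ ((1 + b * bᴴ)⁻¹ * b) hD, Matrix.mul_assoc _ b, ← hpush,
      nonsing_inv_mul_cancel_left _ _ hG]
  rw [hinv, Matrix.mul_assoc, ← add_sub_cancel_left 1 (b * bᴴ), Matrix.mul_sub,
    add_sub_cancel_left, nonsing_inv_mul _ hG, Matrix.mul_one]

-- The Schur complement of the positive block `1 + b₂ᴴ b₂` vanishes.
theorem posSemidef_gram_sub_signature {b : Matrix m (m ⊕ n) 𝕜}
    (h : b * (fromBlocks 1 0 0 (-1) : Matrix (m ⊕ n) (m ⊕ n) 𝕜) * bᴴ = 1) :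
    (bᴴ * b - fromBlocks 1 0 0 (-1)).PosSemidef := by
  obtain ⟨b₁, b₂, rfl⟩ : ∃ b₁ b₂, b = fromCols b₁ b₂ :=
    ⟨b.toCols₁, b.toCols₂, (fromCols_toCols b).symm⟩
  have hG : 1 + b₂ * b₂ᴴ = b₁ * b₁ᴴ := by
    rw [conjTranspose_fromCols_eq_fromRows_conjTranspose, fromCols_mul_fromBlocks,
      fromCols_mul_fromRows] at h
    rw [← h]
    simp
  have hD : (1 + b₂ᴴ * b₂).PosDef :=
    PosDef.one.add_posSemidef (posSemidef_conjTranspose_mul_self b₂)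
  have hb₁ : IsUnit b₁.det := by
    have hunit := (PosDef.one.add_posSemidef (posSemidef_self_mul_conjTranspose b₂)).isUnit
    rw [hG, isUnit_iff_isUnit_det, det_mul] at hunit
    exact isUnit_of_mul_isUnit_left hunit
  have hblocks : (fromCols b₁ b₂)ᴴ * fromCols b₁ b₂ - fromBlocks 1 0 0 (-1) =
      fromBlocks (b₁ᴴ * b₁ - 1) (b₁ᴴ * b₂) (b₁ᴴ * b₂)ᴴ (1 + b₂ᴴ * b₂) := by
    rw [conjTranspose_fromCols_eq_fromRows_conjTranspose, fromRows_mul_fromCols, conjTranspose_mul,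
      conjTranspose_conjTranspose]
    ext (i | i) (j | j) <;> simp [add_comm]
  have hschur : b₁ᴴ * b₁ - 1 - b₁ᴴ * b₂ * (1 + b₂ᴴ * b₂)⁻¹ * (b₁ᴴ * b₂)ᴴ = 0 := by
    have hassoc : b₁ᴴ * b₂ * (1 + b₂ᴴ * b₂)⁻¹ * (b₁ᴴ * b₂)ᴴ =
        b₁ᴴ * (b₂ * (1 + b₂ᴴ * b₂)⁻¹ * b₂ᴴ) * b₁ := by
      simp only [conjTranspose_mul, conjTranspose_conjTranspose, Matrix.mul_assoc]
    have hone : b₁ᴴ * (1 + b₂ * b₂ᴴ)⁻¹ * b₁ = 1 := by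
      rw [hG, Matrix.mul_inv_rev, ← Matrix.mul_assoc, Matrix.mul_assoc _ b₁⁻¹,
        nonsing_inv_mul _ hb₁, Matrix.mul_one, mul_nonsing_inv]
      rw [det_conjTranspose]
      exact hb₁.star
    rw [hassoc, mul_inv_one_add_gram_mul_conjTranspose, Matrix.mul_sub, Matrix.sub_mul,
      Matrix.mul_one, hone, sub_self]
  have := hD.isUnit.invertible
  rw [hblocks, PosDef.fromBlocks₂₂ _ _ hD, hschur]
  exact PosSemidef.zero

theorem two_smul_gram_sub_mul_mul_self {s : Matrix n n 𝕜} {b : Matrix m n 𝕜} (hs : s * s = 1)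
    (h : b * s * bᴴ = 1) :
    ((2 : 𝕜) • (bᴴ * b) - s) * s * ((2 : 𝕜) • (bᴴ * b) - s) = s := by
  have hproj : bᴴ * b * s * (bᴴ * b) = bᴴ * b := by
    calc bᴴ * b * s * (bᴴ * b) = bᴴ * (b * s * bᴴ) * b := by simp only [Matrix.mul_assoc]
      _ = bᴴ * b := by rw [h, Matrix.mul_one]
  simp only [Matrix.sub_mul, Matrix.mul_sub, smul_mul_assoc, mul_smul_comm, hproj, hs,
    Matrix.one_mul]
  rw [Matrix.mul_assoc _ s s, hs, Matrix.mul_one]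
  module

theorem posDef_two_smul_gram_sub {s : Matrix n n 𝕜} {b : Matrix m n 𝕜} (hs : s * s = 1)
    (h : b * s * bᴴ = 1) (hpos : (bᴴ * b - s).PosSemidef) : ((2 : 𝕜) • (bᴴ * b) - s).PosDef := by
  have hpsd : ((2 : 𝕜) • (bᴴ * b) - s).PosSemidef := by
    rw [two_smul, add_sub_assoc]
    exact (posSemidef_conjTranspose_mul_self b).add hpos
  have hinv : ((2 : 𝕜) • (bᴴ * b) - s) * (s * ((2 : 𝕜) • (bᴴ * b) - s) * s) = 1 := by
    rw [← Matrix.mul_assoc, ← Matrix.mul_assoc, two_smul_gram_sub_mul_mul_self hs h, hs]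
  exact hpsd.posDef_iff_isUnit.mpr (IsUnit.of_mul_eq_one _ hinv)

theorem isUnit_mul_mul_conjTranspose {s : Matrix n n 𝕜} {b c : Matrix m n 𝕜}
    (hsH : s.IsHermitian) (hs : s * s = 1) (hc : c * s * cᴴ = 1) (hpos : (bᴴ * b - s).PosSemidef) :
    IsUnit (b * s * cᴴ) := by
  have hgram : (b * s * cᴴ)ᴴ * (b * s * cᴴ) = 1 + (s * cᴴ)ᴴ * (bᴴ * b - s) * (s * cᴴ) := by
    have hcross : (s * cᴴ)ᴴ * s * (s * cᴴ) = 1 := by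
      rw [conjTranspose_mul, conjTranspose_conjTranspose, hsH.eq, Matrix.mul_assoc c, hs,
        Matrix.mul_one, ← Matrix.mul_assoc, hc]
    rw [Matrix.mul_sub, Matrix.sub_mul, hcross, add_sub_cancel]
    simp only [conjTranspose_mul, Matrix.mul_assoc]
  have hunit := (PosDef.one.add_posSemidef
    (hpos.conjTranspose_mul_mul_same (s * cᴴ))).isUnit
  rw [← hgram, isUnit_iff_isUnit_det, det_mul] at hunit
  exact (isUnit_iff_isUnit_det _).mpr (isUnit_of_mul_isUnit_right hunit)

end Positivity

section Signature

variable {p : ℕ}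

theorem sigj_mul_self (p : ℕ) : sigj p * sigj p = 1 := by
  simp [sigj, fromBlocks_multiply]

theorem sigJ_mul_self (p : ℕ) : sigJ p * sigJ p = 1 := by
  simp [sigJ, fromBlocks_multiply]

theorem isHermitian_sigj (p : ℕ) : (sigj p).IsHermitian := by
  simp [IsHermitian, sigj, fromBlocks_conjTranspose]

theorem isHermitian_sigJ (p : ℕ) : (sigJ p).IsHermitian := by
  simp [IsHermitian, sigJ, fromBlocks_conjTranspose]

theorem matK_mul_sigj (p : ℕ) : matK p * sigj p = sigJ p * matK p := by
  simp [matK, sigj, sigJ, fromBlocks_multiply]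

theorem matK_mul_conjTranspose (p : ℕ) : matK p * (matK p)ᴴ = 1 := by
  have hsqrt : ((√2 : ℝ) : ℂ)⁻¹ * ((√2 : ℝ) : ℂ)⁻¹ = 2⁻¹ := by
    rw [← mul_inv, ← Complex.ofReal_mul, Real.mul_self_sqrt zero_le_two, ofReal_ofNat]
  rw [matK, conjTranspose_smul, smul_mul_assoc, mul_smul_comm, smul_smul, star_inv₀, star_def,
    conj_ofReal, hsqrt, fromBlocks_conjTranspose, fromBlocks_multiply, fromBlocks_smul,
    ← fromBlocks_one]
  congr 1 <;> simp [← two_smul ℂ, smul_smul]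

theorem matK_mul_sigj_mul_conjTranspose (p : ℕ) : matK p * sigj p * (matK p)ᴴ = sigJ p := by
  rw [matK_mul_sigj, Matrix.mul_assoc, matK_mul_conjTranspose, Matrix.mul_one]

theorem mul_matK_mul_sigj_mul_conjTranspose (β : Matrix (Fin p) (Fin p ⊕ Fin p) ℂ) :
    β * matK p * sigj p * (β * matK p)ᴴ = β * sigJ p * βᴴ := by
  rw [← matK_mul_sigj_mul_conjTranspose, conjTranspose_mul]
  simp only [Matrix.mul_assoc]

theorem posSemidef_gram_sub_sigJ {β : Matrix (Fin p) (Fin p ⊕ Fin p) ℂ}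
    (h : β * sigJ p * βᴴ = 1) : (βᴴ * β - sigJ p).PosSemidef := by
  have hconj : matK p * ((β * matK p)ᴴ * (β * matK p) - sigj p) * (matK p)ᴴ =
      βᴴ * β - sigJ p := by
    have hgram : matK p * ((β * matK p)ᴴ * (β * matK p)) * (matK p)ᴴ =
        matK p * (matK p)ᴴ * (βᴴ * β) * (matK p * (matK p)ᴴ) := by
      simp only [conjTranspose_mul, Matrix.mul_assoc]
    rw [Matrix.mul_sub, Matrix.sub_mul, matK_mul_sigj_mul_conjTranspose, hgram,
      matK_mul_conjTranspose, Matrix.one_mul, Matrix.mul_one]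
  rw [← hconj]
  exact (posSemidef_gram_sub_signature
    ((mul_matK_mul_sigj_mul_conjTranspose β).trans h)).mul_mul_conjTranspose_same _

theorem det_mul_sigJ_mul_ne_zero {β γ : Matrix (Fin p) (Fin p ⊕ Fin p) ℂ}
    (hβ : β * sigJ p * βᴴ = 1) (hγ : γ * sigJ p * γᴴ = 1) : (β * sigJ p * γᴴ).det ≠ 0 :=
  ((isUnit_iff_isUnit_det _).mp (isUnit_mul_mul_conjTranspose (isHermitian_sigJ p)
    (sigJ_mul_self p) hγ (posSemidef_gram_sub_sigJ hβ))).ne_zero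

end Signature

namespace HasRepresentation

variable {p N : ℕ} {C : ℕ → Matrix (Fin p ⊕ Fin p) (Fin p ⊕ Fin p) ℂ}
  {β : ℕ → Matrix (Fin p) (Fin p ⊕ Fin p) ℂ} {k : ℕ}

theorem eq_two_smul_gram_sub (hC : HasRepresentation N C β) (hk : k ≤ N) :
    C k = (2 : ℂ) • ((β k * matK p)ᴴ * (β k * matK p)) - sigj p := by
  rw [(hC k hk).1, conjTranspose_mul]
  simp only [Matrix.mul_assoc]

theorem mul_matK_mul_sigj_mul_eq_one (hC : HasRepresentation N C β) (hk : k ≤ N) :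
    β k * matK p * sigj p * (β k * matK p)ᴴ = 1 :=
  (mul_matK_mul_sigj_mul_conjTranspose _).trans (hC k hk).2

theorem mul_sigj_mul_self (hC : HasRepresentation N C β) (hk : k ≤ N) :
    C k * sigj p * C k = sigj p := by
  rw [hC.eq_two_smul_gram_sub hk]
  exact two_smul_gram_sub_mul_mul_self (sigj_mul_self p) (hC.mul_matK_mul_sigj_mul_eq_one hk)

theorem posDef (hC : HasRepresentation N C β) (hk : k ≤ N) : (C k).PosDef := by
  have hnorm := hC.mul_matK_mul_sigj_mul_eq_one hk
  rw [hC.eq_two_smul_gram_sub hk]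
  exact posDef_two_smul_gram_sub (sigj_mul_self p) hnorm (posSemidef_gram_sub_signature hnorm)

end HasRepresentation

section EntrywiseAnalytic

variable {𝕜 m n o : Type*} [NontriviallyNormedField 𝕜] {z₀ : 𝕜}

/-- Entrywise analyticity of a matrix function at a point; it avoids the choice of a norm on
matrices. -/
def EntrywiseAnalyticAt (F : 𝕜 → Matrix m n 𝕜) (z₀ : 𝕜) : Prop :=
  ∀ a b, AnalyticAt 𝕜 (fun z => F z a b) z₀

namespace EntrywiseAnalyticAt

theorem const (M : Matrix m n 𝕜) (z₀ : 𝕜) : EntrywiseAnalyticAt (fun _ => M) z₀ :=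
  fun _ _ => analyticAt_const

theorem congr {F G : 𝕜 → Matrix m n 𝕜} (hF : EntrywiseAnalyticAt F z₀) (h : F =ᶠ[𝓝 z₀] G) :
    EntrywiseAnalyticAt G z₀ := fun a b =>
  (hF a b).congr (h.mono fun _ hz => congrFun (congrFun hz a) b)

theorem comp {F : 𝕜 → Matrix m n 𝕜} {w : 𝕜 → 𝕜} (hF : EntrywiseAnalyticAt F (w z₀))
    (hw : AnalyticAt 𝕜 w z₀) : EntrywiseAnalyticAt (fun z => F (w z)) z₀ :=
  fun a b => (hF a b).comp hw

theorem smul {c : 𝕜 → 𝕜} {F : 𝕜 → Matrix m n 𝕜} (hc : AnalyticAt 𝕜 c z₀)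
    (hF : EntrywiseAnalyticAt F z₀) : EntrywiseAnalyticAt (fun z => c z • F z) z₀ :=
  fun a b => hc.mul (hF a b)

theorem mul [Fintype n] {F : 𝕜 → Matrix m n 𝕜} {G : 𝕜 → Matrix n o 𝕜}
    (hF : EntrywiseAnalyticAt F z₀) (hG : EntrywiseAnalyticAt G z₀) :
    EntrywiseAnalyticAt (fun z => F z * G z) z₀ := fun a b => by
  simp only [Matrix.mul_apply]
  exact Finset.analyticAt_fun_sum _ fun i _ => (hF a i).mul (hG i b)

theorem fromRows {F : 𝕜 → Matrix m n 𝕜} {G : 𝕜 → Matrix o n 𝕜} (hF : EntrywiseAnalyticAt F z₀)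
    (hG : EntrywiseAnalyticAt G z₀) : EntrywiseAnalyticAt (fun z => (F z).fromRows (G z)) z₀
  | .inl a, b => hF a b
  | .inr a, b => hG a b

theorem det [Fintype n] [DecidableEq n] {F : 𝕜 → Matrix n n 𝕜} (hF : EntrywiseAnalyticAt F z₀) :
    AnalyticAt 𝕜 (fun z => (F z).det) z₀ := by
  simp only [det_apply']
  exact Finset.analyticAt_fun_sum _ fun σ _ =>
    analyticAt_const.mul (Finset.analyticAt_fun_prod _ fun i _ => hF _ _)

theorem inv [Fintype n] [DecidableEq n] {F : 𝕜 → Matrix n n 𝕜} (hF : EntrywiseAnalyticAt F z₀)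
    (h : (F z₀).det ≠ 0) : EntrywiseAnalyticAt (fun z => (F z)⁻¹) z₀ := by
  simp only [Matrix.inv_def, Ring.inverse_eq_inv']
  refine smul (hF.det.inv h) fun a b => ?_
  simp only [adjugate_apply]
  refine det fun i j => ?_
  rcases eq_or_ne i b with rfl | hi
  · simpa only [updateRow_self] using analyticAt_const
  · simpa only [updateRow_ne hi] using hF i j

theorem pencil [DecidableEq n] (P : Matrix n n 𝕜) (z₀ : 𝕜) :
    EntrywiseAnalyticAt (fun z => pencil z P) z₀ := fun a b => by
  simp only [DiscreteDirac.pencil, Matrix.add_apply, Matrix.smul_apply, smul_eq_mul]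
  fun_prop

end EntrywiseAnalyticAt

end EntrywiseAnalytic

section TaylorSeries

open scoped PowerSeries

variable {𝕜 : Type*} [NontriviallyNormedField 𝕜] {f g : 𝕜 → 𝕜}

/-- The Taylor series of a function at `0` as a formal power series. -/
noncomputable def taylorSeries (f : 𝕜 → 𝕜) : 𝕜⟦X⟧ :=
  PowerSeries.mk fun k => iteratedDeriv k f 0 / (k.factorial : 𝕜)

theorem taylorSeries_congr (h : f =ᶠ[𝓝 0] g) : taylorSeries f = taylorSeries g := by
  ext k
  rw [taylorSeries, taylorSeries, PowerSeries.coeff_mk, PowerSeries.coeff_mk, h.iteratedDeriv_eq]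

theorem taylorSeries_const (c : 𝕜) : taylorSeries (fun _ => c) = PowerSeries.C c := by
  ext (_ | k) <;> simp [taylorSeries, iteratedDeriv_const, PowerSeries.coeff_C]

theorem taylorSeries_id : taylorSeries (fun z : 𝕜 => z) = PowerSeries.X := by
  ext (_ | _ | k) <;>
  simp [taylorSeries, iteratedDeriv_succ', iteratedDeriv_const, PowerSeries.coeff_X]

theorem taylorSeries_neg (f : 𝕜 → 𝕜) : taylorSeries (fun z => -f z) = -taylorSeries f := by
  ext k
  simp [taylorSeries, iteratedDeriv_fun_neg, neg_div]

variable [CompleteSpace 𝕜]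

theorem taylorSeries_add (hf : AnalyticAt 𝕜 f 0) (hg : AnalyticAt 𝕜 g 0) :
    taylorSeries (fun z => f z + g z) = taylorSeries f + taylorSeries g := by
  ext k
  simp [taylorSeries, iteratedDeriv_fun_add hf.contDiffAt hg.contDiffAt, add_div]

theorem taylorSeries_sum {ι : Type*} {s : Finset ι} {F : ι → 𝕜 → 𝕜}
    (h : ∀ i ∈ s, AnalyticAt 𝕜 (F i) 0) :
    taylorSeries (fun z => ∑ i ∈ s, F i z) = ∑ i ∈ s, taylorSeries (F i) := by
  ext k
  simp [taylorSeries, iteratedDeriv_fun_sum fun i hi => (h i hi).contDiffAt, Finset.sum_div]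

theorem taylorSeries_mul [CharZero 𝕜] (hf : AnalyticAt 𝕜 f 0) (hg : AnalyticAt 𝕜 g 0) :
    taylorSeries (fun z => f z * g z) = taylorSeries f * taylorSeries g := by
  ext k
  rw [PowerSeries.coeff_mul, Finset.Nat.sum_antidiagonal_eq_sum_range_succ_mk]
  simp only [taylorSeries, PowerSeries.coeff_mk]
  rw [iteratedDeriv_fun_mul hf.contDiffAt hg.contDiffAt, Finset.sum_div]
  refine Finset.sum_congr rfl fun i hi => ?_
  have hne (j : ℕ) : (j.factorial : 𝕜) ≠ 0 := Nat.cast_ne_zero.mpr j.factorial_ne_zero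
  have hk := hne k
  have hi' := hne i
  have hki := hne (k - i)
  rw [Nat.cast_choose 𝕜 (Finset.mem_range_succ_iff.mp hi)]
  field_simp

end TaylorSeries

section TaylorMatrix

open scoped PowerSeries

variable {𝕜 m n o : Type*} [NontriviallyNormedField 𝕜]

/-- The Taylor series at `0` of a matrix function, as a matrix of formal power series. -/
noncomputable def taylorMatrix (F : 𝕜 → Matrix m n 𝕜) : Matrix m n 𝕜⟦X⟧ :=
  of fun a b => taylorSeries fun z => F z a b

theorem taylorMatrix_congr {F G : 𝕜 → Matrix m n 𝕜} (h : F =ᶠ[𝓝 0] G) :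
    taylorMatrix F = taylorMatrix G := by
  ext1 a b
  exact taylorSeries_congr (h.mono fun _ hz => congrFun (congrFun hz a) b)

theorem taylorMatrix_fromRows_neg_one [DecidableEq n] (F : 𝕜 → Matrix m n 𝕜) :
    taylorMatrix (fun z => fromRows (-F z) (1 : Matrix n n 𝕜)) = fromRows (-taylorMatrix F) 1 := by
  ext1 (a | a) b
  · exact taylorSeries_neg _
  · exact (taylorSeries_const _).trans ((Matrix.map_apply ..).symm.trans
      (congrFun (congrFun (Matrix.map_one _ (map_zero _) (map_one _)) a) b))

variable [CompleteSpace 𝕜] [CharZero 𝕜]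

theorem taylorMatrix_mul [Fintype n] {F : 𝕜 → Matrix m n 𝕜} {G : 𝕜 → Matrix n o 𝕜}
    (hF : EntrywiseAnalyticAt F 0) (hG : EntrywiseAnalyticAt G 0) :
    taylorMatrix (fun z => F z * G z) = taylorMatrix F * taylorMatrix G := by
  ext1 a b
  simp only [taylorMatrix, of_apply, Matrix.mul_apply]
  rw [taylorSeries_sum fun i _ => (hF a i).fun_mul (hG i b)]
  exact Finset.sum_congr rfl fun i _ => taylorSeries_mul (hF a i) (hG i b)

theorem taylorMatrix_pencil [DecidableEq n] (P : Matrix n n 𝕜) :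
    taylorMatrix (fun z => pencil z P) = pencil PowerSeries.X (P.map PowerSeries.C) := by
  ext1 a b
  have hid : AnalyticAt 𝕜 (fun z : 𝕜 => z) 0 := analyticAt_id
  have hsub : AnalyticAt 𝕜 (fun z : 𝕜 => z + -1) 0 := hid.add analyticAt_const
  have hone : PowerSeries.C ((1 : Matrix n n 𝕜) a b) = (1 : Matrix n n 𝕜⟦X⟧) a b := by
    rw [← Matrix.map_apply (f := PowerSeries.C), Matrix.map_one _ (map_zero _) (map_one _)]
  simp only [taylorMatrix, of_apply, pencil, Matrix.add_apply, Matrix.smul_apply, smul_eq_mul,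
    sub_eq_add_neg, Matrix.map_apply]
  rw [taylorSeries_add analyticAt_const (hsub.fun_mul analyticAt_const),
    taylorSeries_mul hsub analyticAt_const, taylorSeries_add hid analyticAt_const,
    taylorSeries_const, taylorSeries_const, taylorSeries_const, taylorSeries_id, hone, map_neg,
    map_one]

end TaylorMatrix

section PencilProduct

variable {R o : Type*} [CommRing R] [Fintype o] [DecidableEq o]

/-- The ordered product of the pencils `pencil z (P i)`, `l ≤ i < n`. -/
def pencilProd (P : ℕ → Matrix o o R) (z : R) (l n : ℕ) : Matrix o o R :=
  ((List.Ico l n).map fun i => pencil z (P i)).prod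

theorem pencilProd_self (P : ℕ → Matrix o o R) (z : R) (n : ℕ) : pencilProd P z n n = 1 := by
  simp [pencilProd]

theorem pencilProd_succ_right (P : ℕ → Matrix o o R) (z : R) {l n : ℕ} (h : l ≤ n) :
    pencilProd P z l (n + 1) = pencilProd P z l n * pencil z (P n) := by
  rw [pencilProd, List.Ico.succ_top h]
  simp [pencilProd]

theorem pencilProd_of_lt (P : ℕ → Matrix o o R) (z : R) {l n : ℕ} (h : l < n) :
    pencilProd P z l n = pencil z (P l) * pencilProd P z (l + 1) n := by
  rw [pencilProd, List.Ico.eq_cons h, List.map_cons, List.prod_cons, pencilProd]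

theorem EntrywiseAnalyticAt.pencilProd {𝕜 : Type*} [NontriviallyNormedField 𝕜]
    (P : ℕ → Matrix o o 𝕜) (z₀ : 𝕜) {l n : ℕ} (h : l ≤ n) :
    EntrywiseAnalyticAt (fun z => pencilProd P z l n) z₀ := by
  induction n, h using Nat.le_induction with
  | base => simpa only [pencilProd_self] using .const 1 z₀
  | succ n h ih => simpa only [pencilProd_succ_right P _ h] using ih.mul (.pencil (P n) z₀)

theorem isPencilChain_of_pencilProd_mul {m n 𝕜 : Type*} [Fintype m] [Fintype n] [DecidableEq m]
    [DecidableEq n] [NontriviallyNormedField 𝕜] [CompleteSpace 𝕜] [CharZero 𝕜] {N : ℕ}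
    {β : ℕ → Matrix m (m ⊕ n) 𝕜} {γ : ℕ → Matrix (m ⊕ n) m 𝕜} {F : 𝕜 → Matrix m n 𝕜}
    {H : 𝕜 → Matrix (m ⊕ n) n 𝕜} (hβγ : ∀ l < N, β l * γ l = 1) (hH : EntrywiseAnalyticAt H 0)
    (hF : ∀ᶠ z in 𝓝 0, pencilProd (fun l => γ l * β l) z 0 N * H z = fromRows (-F z) 1) :
    IsPencilChain N (taylorMatrix F) β γ
      fun l => taylorMatrix fun z => pencilProd (fun l => γ l * β l) z l N * H z where
  mul_eq_one := hβγ
  zero := (taylorMatrix_congr hF).trans (taylorMatrix_fromRows_neg_one F)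
  step l hl := by
    simp only [pencilProd_of_lt _ _ hl, Matrix.mul_assoc]
    rw [taylorMatrix_mul (.pencil _ 0) ((EntrywiseAnalyticAt.pencilProd _ 0 hl).mul hH),
      taylorMatrix_pencil]

end PencilProduct

section SpectralParameter

/-- The Möbius map `z ↦ i (z + 1) / (z - 1)` from the disc variable to the spectral parameter. -/
noncomputable def spectralParam (z : ℂ) : ℂ := I * ((z + 1) / (z - 1))

theorem spectralParam_zero : spectralParam 0 = -I := by simp [spectralParam]

theorem analyticAt_spectralParam : AnalyticAt ℂ spectralParam 0 :=
  analyticAt_const.mul ((analyticAt_id.add analyticAt_const).div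
    (analyticAt_id.sub analyticAt_const) (by simp))

theorem star_I_div_conj_spectralParam (z : ℂ) :
    star (I / conj (spectralParam z)) = -((z - 1) / (z + 1)) := by
  rw [star_def, map_div₀, conj_conj, conj_I, spectralParam, neg_div, ← div_div, div_self I_ne_zero,
    one_div_div]

theorem eventually_add_one_ne_zero : ∀ᶠ z : ℂ in 𝓝 0, z + 1 ≠ 0 :=
  ContinuousAt.eventually_ne (by fun_prop) (by simp)

theorem one_add_div_smul_eq_smul_pencil {K o : Type*} [Field K] [DecidableEq o] {z : K}
    (hz : z + 1 ≠ 0) (P : Matrix o o K) :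
    1 + ((z - 1) / (z + 1)) • ((2 : K) • P - 1) = (2 / (z + 1)) • pencil z P := by
  rw [pencil]
  match_scalars
  · field_simp
    ring
  · field_simp

end SpectralParameter

section WeylFunction

variable {p N : ℕ} {C : ℕ → Matrix (Fin p ⊕ Fin p) (Fin p ⊕ Fin p) ℂ}
  {β : ℕ → Matrix (Fin p) (Fin p ⊕ Fin p) ℂ} {φ : ℂ → Matrix (Fin p) (Fin p) ℂ}

theorem sigJ_mul_fromRows {n : Type*} (X Y : Matrix (Fin p) n ℂ) :
    sigJ p * fromRows X Y = fromRows Y X := by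
  rw [sigJ, fromBlocks_mul_fromRows]
  simp only [Matrix.zero_mul, Matrix.one_mul, zero_add, add_zero]

theorem HasRepresentation.sigJ_mul_matK_mul (hC : HasRepresentation N C β) {n : ℕ} (hn : n ≤ N) :
    sigJ p * matK p * (C n * sigj p) =
      ((2 : ℂ) • (sigJ p * (β n)ᴴ * β n) - 1) * (sigJ p * matK p) := by
  have hgram : sigJ p * matK p * ((matK p)ᴴ * (β n)ᴴ * β n * matK p * sigj p) =
      sigJ p * (matK p * (matK p)ᴴ) * ((β n)ᴴ * β n) * (matK p * sigj p) := by
    simp only [Matrix.mul_assoc]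
  rw [(hC n hn).1, Matrix.sub_mul, sigj_mul_self, Matrix.mul_sub, Matrix.sub_mul, Matrix.smul_mul,
    Matrix.mul_smul, Matrix.smul_mul, Matrix.mul_one, Matrix.one_mul, hgram,
    matK_mul_conjTranspose, matK_mul_sigj, Matrix.mul_one, Matrix.mul_assoc (sigJ p) (β n)ᴴ]

theorem HasRepresentation.conjTranspose_fundSol_succ (hC : HasRepresentation N C β) {n : ℕ}
    (hn : n ≤ N) (z : ℂ) :
    (fundSol C (n + 1) (conj (spectralParam z)))ᴴ =
      (fundSol C n (conj (spectralParam z)))ᴴ *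
        (1 + ((z - 1) / (z + 1)) • (C n * sigj p)) := by
  rw [fundSol, conjTranspose_sub, conjTranspose_smul, star_I_div_conj_spectralParam,
    conjTranspose_mul, conjTranspose_mul, (isHermitian_sigj p).eq, (hC.posDef hn).isHermitian.eq,
    Matrix.mul_add, Matrix.mul_one, Matrix.mul_smul, neg_smul, sub_neg_eq_add]

theorem HasRepresentation.sigJ_mul_matK_mul_conjTranspose_fundSol (hC : HasRepresentation N C β)
    {z : ℂ} (hz : z + 1 ≠ 0) {n : ℕ} (hn : n ≤ N + 1) :
    sigJ p * matK p * (fundSol C n (conj (spectralParam z)))ᴴ =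
      (2 / (z + 1)) ^ n •
        (pencilProd (fun l => sigJ p * (β l)ᴴ * β l) z 0 n * (sigJ p * matK p)) := by
  induction n with
  | zero => simp [fundSol, pencilProd_self]
  | succ n ih =>
    have hstep : sigJ p * matK p * (1 + ((z - 1) / (z + 1)) • (C n * sigj p)) =
        (2 / (z + 1)) • pencil z (sigJ p * (β n)ᴴ * β n) * (sigJ p * matK p) := by
      rw [← one_add_div_smul_eq_smul_pencil hz, Matrix.mul_add, Matrix.mul_smul,
        hC.sigJ_mul_matK_mul (by omega), Matrix.add_mul, Matrix.smul_mul, Matrix.mul_one,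
        Matrix.one_mul]
    rw [hC.conjTranspose_fundSol_succ (by omega), ← Matrix.mul_assoc, ih (by omega),
      Matrix.smul_mul, Matrix.mul_assoc, hstep, Matrix.smul_mul, Matrix.mul_smul, smul_smul,
      ← pow_succ, ← Matrix.mul_assoc, ← pencilProd_succ_right _ _ n.zero_le]

theorem HasRepresentation.pencilProd_mul_smul_eq_fromRows (hC : HasRepresentation N C β) {z : ℂ}
    (hz : z + 1 ≠ 0) (X Y : Matrix (Fin p) (Fin p) ℂ) :
    pencilProd (fun l => sigJ p * (β l)ᴴ * β l) z 0 (N + 1) *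
        ((2 / (z + 1)) ^ (N + 1) • (sigJ p * matK p * fromRows X Y)) =
      fromRows
        ((calW N C (spectralParam z)).toBlocks₂₁ * X + (calW N C (spectralParam z)).toBlocks₂₂ * Y)
        ((calW N C (spectralParam z)).toBlocks₁₁ * X +
          (calW N C (spectralParam z)).toBlocks₁₂ * Y) := by
  have hswap : sigJ p * (calW N C (spectralParam z) * fromRows X Y) = fromRows
      ((calW N C (spectralParam z)).toBlocks₂₁ * X + (calW N C (spectralParam z)).toBlocks₂₂ * Y)
      ((calW N C (spectralParam z)).toBlocks₁₁ * X +
        (calW N C (spectralParam z)).toBlocks₁₂ * Y) := by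
    conv_lhs => rw [← fromBlocks_toBlocks (calW N C _), fromBlocks_mul_fromRows, sigJ_mul_fromRows]
  rw [← hswap, calW, ← Matrix.mul_assoc, ← Matrix.mul_assoc,
    hC.sigJ_mul_matK_mul_conjTranspose_fundSol hz le_rfl, Matrix.smul_mul, Matrix.mul_smul,
    Matrix.mul_assoc (pencilProd _ z 0 (N + 1))]

theorem fromRows_mul_toRows₂_inv {m n R : Type*} [Fintype n] [DecidableEq n] [CommRing R]
    {M : Matrix (m ⊕ n) n R} (hM : IsUnit M.toRows₂.det) :
    M * M.toRows₂⁻¹ = fromRows (M.toRows₁ * M.toRows₂⁻¹) 1 := by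
  rw [← mul_nonsing_inv _ hM, ← fromRows_mul, fromRows_toRows]

theorem IsMoebiusTransform.exists_eventually_pencilProd_mul_eq (hφ : IsMoebiusTransform N C φ)
    (hC : HasRepresentation N C β) :
    ∃ H : ℂ → Matrix (Fin p ⊕ Fin p) (Fin p) ℂ, EntrywiseAnalyticAt H 0 ∧
      ∀ᶠ z in 𝓝 0, pencilProd (fun l => sigJ p * (β l)ᴴ * β l) z 0 (N + 1) * H z =
        fromRows (-cayley φ z) 1 := by
  obtain ⟨R, Q, hR, hQ, hdet, hev⟩ := hφ
  set G : ℂ → Matrix (Fin p ⊕ Fin p) (Fin p ⊕ Fin p) ℂ :=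
    fun z => pencilProd (fun l => sigJ p * (β l)ᴴ * β l) z 0 (N + 1)
  set V : ℂ → Matrix (Fin p ⊕ Fin p) (Fin p) ℂ := fun z => (2 / (z + 1)) ^ (N + 1) •
    (sigJ p * matK p * fromRows (R (spectralParam z)) (Q (spectralParam z)))
  have hV : EntrywiseAnalyticAt V 0 := by
    refine .smul ((analyticAt_const.div (analyticAt_id.add analyticAt_const) (by simp)).pow _)
      ((EntrywiseAnalyticAt.const _ 0).mul (.fromRows (.comp ?_ analyticAt_spectralParam)
        (.comp ?_ analyticAt_spectralParam))) <;>
    rw [spectralParam_zero] <;> assumption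
  have hGV : EntrywiseAnalyticAt (fun z => G z * V z) 0 :=
    (EntrywiseAnalyticAt.pencilProd _ 0 (Nat.zero_le _)).mul hV
  have hrows : ∀ᶠ z in 𝓝 0, G z * V z = fromRows
      ((calW N C (spectralParam z)).toBlocks₂₁ * R (spectralParam z) +
        (calW N C (spectralParam z)).toBlocks₂₂ * Q (spectralParam z))
      ((calW N C (spectralParam z)).toBlocks₁₁ * R (spectralParam z) +
        (calW N C (spectralParam z)).toBlocks₁₂ * Q (spectralParam z)) :=
    eventually_add_one_ne_zero.mono fun z hz => hC.pencilProd_mul_smul_eq_fromRows hz _ _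
  have hdet₀ : ((G 0 * V 0).toRows₂).det ≠ 0 := by
    rwa [hrows.self_of_nhds, toRows₂_fromRows, spectralParam_zero]
  have hrows₂ : EntrywiseAnalyticAt (fun z => (G z * V z).toRows₂) 0 :=
    fun a b => hGV (Sum.inr a) b
  refine ⟨fun z => V z * ((G z * V z).toRows₂)⁻¹, hV.mul (hrows₂.inv hdet₀), ?_⟩
  rw [← spectralParam_zero] at hev
  filter_upwards [hrows, hrows₂.det.continuousAt.eventually_ne hdet₀,
    analyticAt_spectralParam.continuousAt.eventually hev] with z hz hzdet hzφ
  have hcayley : -cayley φ z = (G z * V z).toRows₁ * ((G z * V z).toRows₂)⁻¹ := by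
    rw [cayley, ← spectralParam, hzφ, smul_smul, I_mul_I, neg_one_smul, neg_neg, hz,
      toRows₁_fromRows, toRows₂_fromRows]
  rw [← Matrix.mul_assoc, fromRows_mul_toRows₂_inv hzdet.isUnit, hcayley]

theorem IsMoebiusTransform.analyticAt_cayley (hφ : IsMoebiusTransform N C φ)
    (hC : HasRepresentation N C β) (a b : Fin p) : AnalyticAt ℂ (fun z => cayley φ z a b) 0 := by
  obtain ⟨H, hH, heq⟩ := hφ.exists_eventually_pencilProd_mul_eq hC
  have hprod := ((EntrywiseAnalyticAt.pencilProd _ 0 (Nat.zero_le _)).mul hH).congr heq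
  simpa only [fromRows_apply_inl, Matrix.neg_apply, neg_neg] using (hprod (.inl a) b).fun_neg

theorem IsMoebiusTransform.exists_isPencilChain (hφ : IsMoebiusTransform N C φ)
    (hC : HasRepresentation N C β) :
    ∃ F, IsPencilChain (N + 1) (taylorMatrix (cayley φ)) β (fun l => sigJ p * (β l)ᴴ) F := by
  obtain ⟨H, hH, heq⟩ := hφ.exists_eventually_pencilProd_mul_eq hC
  refine ⟨_, isPencilChain_of_pencilProd_mul (fun l hl => ?_) hH heq⟩
  rw [← Matrix.mul_assoc, (hC l (Nat.lt_succ_iff.mp hl)).2]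

theorem coeffMatrix_taylorMatrix_cayley (φ : ℂ → Matrix (Fin p) (Fin p) ℂ) (k : ℕ) :
    coeffMatrix k (taylorMatrix (cayley φ)) = taylorCoeff φ k := by
  ext a b
  simp [taylorMatrix, taylorSeries, taylorCoeff]

end WeylFunction

section Recovery

variable {p N : ℕ} {C : ℕ → Matrix (Fin p ⊕ Fin p) (Fin p ⊕ Fin p) ℂ}
  {β : ℕ → Matrix (Fin p) (Fin p ⊕ Fin p) ℂ} {φ : ℂ → Matrix (Fin p) (Fin p) ℂ}

theorem matPi_eq_blockColumn (α : ℕ → Matrix (Fin p) (Fin p) ℂ) (r : ℕ) :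
    matPi α r = blockColumn (r + 1) fun k => fromCols 1 (∑ i ∈ Finset.range (k + 1), α i) :=
  rfl

theorem matPi_congr {α α' : ℕ → Matrix (Fin p) (Fin p) ℂ} {r : ℕ} (h : ∀ k ≤ r, α' k = α k) :
    matPi α' r = matPi α r :=
  blockColumn_congr fun _ hk => congrArg (fromCols 1) (Finset.sum_congr rfl fun i hi =>
    h i ((Nat.lt_succ_iff.mp (Finset.mem_range.mp hi)).trans (Nat.lt_succ_iff.mp hk)))

theorem matB_conjTranspose_mul_matB (β : ℕ → Matrix (Fin p) (Fin p ⊕ Fin p) ℂ) (r : ℕ) :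
    (matB β r)ᴴ * matB β r = ∑ k ∈ Finset.range (r + 1), (β k)ᴴ * β k :=
  blockColumn_conjTranspose_mul (r + 1) β

theorem conjTranspose_mul_self_eq_sub (β : ℕ → Matrix (Fin p) (Fin p ⊕ Fin p) ℂ) (r : ℕ) :
    (β (r + 1))ᴴ * β (r + 1) =
      (matB β (r + 1))ᴴ * matB β (r + 1) - (matB β r)ᴴ * matB β r := by
  rw [matB_conjTranspose_mul_matB, matB_conjTranspose_mul_matB, Finset.sum_range_succ _ (r + 1),
    add_sub_cancel_left]

theorem conjTranspose_mul_self_zero_eq (β : ℕ → Matrix (Fin p) (Fin p ⊕ Fin p) ℂ) :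
    (β 0)ᴴ * β 0 = (matB β 0)ᴴ * matB β 0 := by
  rw [matB_conjTranspose_mul_matB, zero_add, Finset.sum_range_one]

theorem sub_mul_conjTranspose_eq {m o : Type*} [Fintype m] [Fintype o] {A L T : Matrix m m ℂ}
    {B P : Matrix m o ℂ} {J : Matrix o o ℂ} (hAL : A * L = L * T)
    (hT : T - Tᴴ = I • (B * J * Bᴴ)) (hLB : L * B = P) :
    A * (L * Lᴴ) - L * Lᴴ * Aᴴ = I • (P * J * Pᴴ) := by
  have hstar : Lᴴ * Aᴴ = Tᴴ * Lᴴ := by rw [← conjTranspose_mul, hAL, conjTranspose_mul]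
  calc A * (L * Lᴴ) - L * Lᴴ * Aᴴ = L * (T - Tᴴ) * Lᴴ := by
        rw [← Matrix.mul_assoc, hAL, Matrix.mul_assoc L Lᴴ, hstar, Matrix.mul_sub, Matrix.sub_mul]
        simp only [Matrix.mul_assoc]
    _ = I • (P * J * Pᴴ) := by
        rw [hT, ← hLB, conjTranspose_mul, Matrix.mul_smul, Matrix.smul_mul]
        simp only [Matrix.mul_assoc]

theorem eq_of_matA_mul_sub_eq {r : ℕ} {S T X : Matrix (Fin (r + 1) × Fin p) (Fin (r + 1) × Fin p) ℂ}
    (hS : matA p r * S - S * (matA p r)ᴴ = X) (hT : matA p r * T - T * (matA p r)ᴴ = X) :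
    T = S := by
  refine sub_eq_zero.mp (eq_zero_of_matA_mul_eq ?_)
  rw [Matrix.mul_sub, Matrix.sub_mul]
  exact sub_eq_sub_iff_sub_eq_sub.mp (hT.trans hS.symm)

theorem exists_posDef_iff_matA_mul_sub_eq (hC : HasRepresentation N C β)
    (hφ : IsMoebiusTransform N C φ) :
    ∃ S : Matrix (Fin (N + 1) × Fin p) (Fin (N + 1) × Fin p) ℂ,
      (∀ T : Matrix (Fin (N + 1) × Fin p) (Fin (N + 1) × Fin p) ℂ,
        matA p N * T - T * (matA p N)ᴴ =
          I • (matPi (taylorCoeff φ) N * sigJ p * (matPi (taylorCoeff φ) N)ᴴ) ↔ T = S) ∧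
      S.PosDef ∧
      ∀ (r : ℕ) (hr : r ≤ N), gram (taylorCoeff φ) S r hr = (matB β r)ᴴ * matB β r := by
  obtain ⟨F, hchain⟩ := hφ.exists_isPencilChain hC
  set L := triangularFactor (taylorMatrix (cayley φ)) β fun l => sigJ p * (β l)ᴴ
  have hlower : ∀ k l, k < l → L k l = 0 := fun k l => triangularFactor_eq_zero_of_lt
  have hunit : ∀ r ≤ N, IsUnit (blockMatrix (r + 1) L) := fun r hr =>
    isUnit_blockMatrix hlower fun k hk => hchain.isUnit_triangularFactor_self (by omega)
  have hLB : ∀ r ≤ N, blockMatrix (r + 1) L * matB β r = matPi (taylorCoeff φ) r := fun r hr => by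
    rw [matPi_eq_blockColumn]
    refine (blockMatrix_mul_blockColumn (r + 1) L β).trans (blockColumn_congr fun k hk => ?_)
    rw [(hchain.mono (Nat.succ_le_succ hr)).sum_triangularFactor_mul hk]
    simp only [coeffMatrix_taylorMatrix_cayley]
  have hS := sub_mul_conjTranspose_eq
    (matA_mul_blockMatrix hchain.mul_eq_one fun k hk l hl => hchain.sum_triangularFactor hk hl)
    (triangularModel_sub_conjTranspose (N + 1) β (isHermitian_sigJ p)) (hLB N le_rfl)
  refine ⟨blockMatrix (N + 1) L * (blockMatrix (N + 1) L)ᴴ,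
    fun T => ⟨eq_of_matA_mul_sub_eq hS, fun hT => hT ▸ hS⟩,
    PosDef.mul_conjTranspose_self _ (vecMul_injective_of_isUnit (hunit N le_rfl)), fun r hr => ?_⟩
  rw [gram, leading_mul_conjTranspose hr hlower]
  exact conjTranspose_mul_inv_mul_of_mul_eq (hunit r hr) (hLB r hr)

theorem coefficients_unique {C' : ℕ → Matrix (Fin p ⊕ Fin p) (Fin p ⊕ Fin p) ℂ}
    {β' : ℕ → Matrix (Fin p) (Fin p ⊕ Fin p) ℂ} {φ' : ℂ → Matrix (Fin p) (Fin p) ℂ}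
    (hC : HasRepresentation N C β) (hφ : IsMoebiusTransform N C φ)
    (hC' : HasRepresentation N C' β') (hφ' : IsMoebiusTransform N C' φ')
    (h : ∀ k ≤ N, taylorCoeff φ' k = taylorCoeff φ k) {k : ℕ} (hk : k ≤ N) : C' k = C k := by
  obtain ⟨S, hS, -, hgram⟩ := exists_posDef_iff_matA_mul_sub_eq hC hφ
  obtain ⟨S', hS', -, hgram'⟩ := exists_posDef_iff_matA_mul_sub_eq hC' hφ'
  have hSS : S' = S := by rw [← hS, ← matPi_congr h, hS']
  have hB : ∀ r ≤ N, (matB β' r)ᴴ * matB β' r = (matB β r)ᴴ * matB β r := fun r hr => by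
    rw [← hgram r hr, ← hgram' r hr, gram, gram, matPi_congr fun _ hk => h _ (hk.trans hr), hSS]
  have hβ : (β' k)ᴴ * β' k = (β k)ᴴ * β k := by
    rcases k with _ | k
    · rw [conjTranspose_mul_self_zero_eq, hB 0 hk, ← conjTranspose_mul_self_zero_eq]
    · rw [conjTranspose_mul_self_eq_sub, hB _ hk, hB k (Nat.le_of_succ_le hk),
        ← conjTranspose_mul_self_eq_sub]
  rw [(hC k hk).1, (hC' k hk).1, Matrix.mul_assoc (matK p)ᴴ, hβ, ← Matrix.mul_assoc]

end Recovery

end DiscreteDirac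

theorem mainTheorem1 (p N : ℕ)
    (C : ℕ → Matrix (Fin p ⊕ Fin p) (Fin p ⊕ Fin p) ℂ)
    (β : ℕ → Matrix (Fin p) (Fin p ⊕ Fin p) ℂ)
    (φ : ℂ → Matrix (Fin p) (Fin p) ℂ)
    (hC : DiscreteDirac.HasRepresentation N C β)
    (hφ : DiscreteDirac.IsMoebiusTransform N C φ) :
    (∀ k ≤ N, (C k)ᴴ = C k ∧
      C k * DiscreteDirac.sigj p * C k = DiscreteDirac.sigj p ∧ (C k).PosDef) ∧
    (∀ k, k + 1 ≤ N → (β k * DiscreteDirac.sigJ p * (β (k + 1))ᴴ).det ≠ 0) ∧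
    (∀ a b, AnalyticAt ℂ (fun z => DiscreteDirac.cayley φ z a b) 0) ∧
    (∃ S : Matrix (Fin (N + 1) × Fin p) (Fin (N + 1) × Fin p) ℂ,
      (∀ T : Matrix (Fin (N + 1) × Fin p) (Fin (N + 1) × Fin p) ℂ,
        DiscreteDirac.matA p N * T - T * (DiscreteDirac.matA p N)ᴴ =
          I • (DiscreteDirac.matPi (DiscreteDirac.taylorCoeff φ) N * DiscreteDirac.sigJ p *
            (DiscreteDirac.matPi (DiscreteDirac.taylorCoeff φ) N)ᴴ) ↔ T = S) ∧
      S.PosDef ∧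
      (DiscreteDirac.matPi (DiscreteDirac.taylorCoeff φ) N)ᴴ * S⁻¹ *
          DiscreteDirac.matPi (DiscreteDirac.taylorCoeff φ) N =
        (DiscreteDirac.matB β N)ᴴ * DiscreteDirac.matB β N ∧
      (∀ (r : ℕ) (hr : r ≤ N),
        DiscreteDirac.gram (DiscreteDirac.taylorCoeff φ) S r hr =
          (DiscreteDirac.matB β r)ᴴ * DiscreteDirac.matB β r) ∧
      (β 0)ᴴ * β 0 = DiscreteDirac.gram (DiscreteDirac.taylorCoeff φ) S 0 (Nat.zero_le N) ∧
      (∀ (r : ℕ) (hr : r + 1 ≤ N),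
        (β (r + 1))ᴴ * β (r + 1) =
          DiscreteDirac.gram (DiscreteDirac.taylorCoeff φ) S (r + 1) hr -
            DiscreteDirac.gram (DiscreteDirac.taylorCoeff φ) S r (Nat.le_of_succ_le hr))) ∧
    (∀ (C' : ℕ → Matrix (Fin p ⊕ Fin p) (Fin p ⊕ Fin p) ℂ)
      (β' : ℕ → Matrix (Fin p) (Fin p ⊕ Fin p) ℂ)
      (φ' : ℂ → Matrix (Fin p) (Fin p) ℂ),
      DiscreteDirac.HasRepresentation N C' β' →
      DiscreteDirac.IsMoebiusTransform N C' φ' →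
      (∀ k ≤ N, DiscreteDirac.taylorCoeff φ' k = DiscreteDirac.taylorCoeff φ k) →
      ∀ k ≤ N, C' k = C k) := by
  obtain ⟨S, hS, hpos, hgram⟩ := DiscreteDirac.exists_posDef_iff_matA_mul_sub_eq hC hφ
  refine ⟨fun k hk => ⟨(hC.posDef hk).isHermitian, hC.mul_sigj_mul_self hk, hC.posDef hk⟩,
    fun k hk => DiscreteDirac.det_mul_sigJ_mul_ne_zero (hC k (Nat.le_of_succ_le hk)).2
      (hC (k + 1) hk).2,
    hφ.analyticAt_cayley hC, ⟨S, hS, hpos, hgram N le_rfl, hgram, ?_, fun r hr => ?_⟩,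
    fun C' β' φ' hC' hφ' h k hk => DiscreteDirac.coefficients_unique hC hφ hC' hφ' h hk⟩
  · rw [hgram, DiscreteDirac.conjTranspose_mul_self_zero_eq]
  · rw [hgram, hgram, DiscreteDirac.conjTranspose_mul_self_eq_sub]
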